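/- \textbf{Setting.} Let $\hat c$ be the space of finitely supported real sequences and $\hat k\subset\hat c$ the set of nonincreasing nonnegative ones. A \emph{symmetric norming (s.n.) function} is a norm $\Phi$ on $\hat c$ with $\Phi(1,0,0,\dots)=1$ and $\Phi(\xi_1,\dots,\xi_n,0,\dots)=\Phi(|\xi_{j_1}|,\dots,|\xi_{j_n}|,0,\dots)$ for every permutation $(j_1,\dots,j_n)$ of $(1,\dots,n)$. Its adjoint is the s.n. function $\Phi^*(\eta)=\max_{0\ne\xi\in\hat k}\frac{1}{\Phi(\xi)}\sum_i\eta_i^*\xi_i$, where $\eta^*$ is the nonincreasing rearrangement of $(|\eta_i|)$. An s.n. function $\Phi$ is a \emph{Q-norm} if there is an s.n. function $\Upsilon$ with $\Phi(a)=\Upsilon(a_1^2,a_2^2,\dots)^{1/2}$ for all $a\in\hat c$, and a \emph{Q$^*$-norm} if it is the adjoint of a Q-norm. For $x\in M_n(\mathbb C)$ put $\|x\|_\Phi=\Phi(s_1(x),\dots,s_n(x),0,\dots)$, where $s_j(x)$ are the singular values of $x$ in nonincreasing order. Let $H$ be a separable infinite-dimensional complex Hilbert space. Every $T\in M_n(H)=H\otimes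 M_n(\mathbb C)$ is a finite sum $T=\sum_i\xi_i\otimes T_i$ with $(\xi_i)$ orthonormal and $T_i\in M_n(\mathbb C)$; the map $\rho_T(x)=\sum_iT_ixT_i^*$ on $M_n(\mathbb C)$ does not depend on the choice of this representation. For s.n. functions $\Psi\le\Phi$, $H(\Phi,\Psi)$ denotes $H$ with the matrix norms \[\|T\|_{H(\Phi,\Psi)}=\Big(\sup\{\|\rho_T(x)\|_\Psi : x\in M_n(\mathbb C),\ \|x\|_\Phi\le1\}\Big)^{1/2},\qquad T\in M_n(H).\] \textbf{Theorem.} Let $\Phi$ be a Q$^*$-norm and $\Psi$ a Q-norm. Then $\Psi\le\Phi$, so that $H(\Phi,\Psi)$ is defined, and $H(\Phi,\Psi)$ is an operator space. That is, for each $n$ the function $\|\cdot\|_{H(\Phi,\Psi)}$ is a norm on $M_n(H)$, for $n=1$ it is the norm of $H$, and Ruan's axioms hold: \begin{itemize} \item[(M1)] $\left\|\begin{pmatrix}x&0\\0&y\end{pmatrix}\right\|=\max\{\|x\|,\|y\|\}$ for all $x\in M_m(H)$, $y\in M_n(H)$; \item[(M2)] $\|axb\|\le\|a\|\,\|x\|\,\|b\|$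 for all $x\in M_m(H)$, $a\in M_{n\times m}(\mathbb C)$, $b\in M_{m\times n}(\mathbb C)$. \end{itemize} -/

import Mathlib

/-! ### Symmetric norming functions

The space `ĉ` of finitely supported real sequences is `ℕ →₀ ℝ` (indices start at `0`). -/

/-- The cone `k̂` of finitely supported, nonincreasing, nonnegative sequences. -/
def decreasingCone : Set (ℕ →₀ ℝ) :=
  {ξ | Antitone (fun i => ξ i) ∧ ∀ i, 0 ≤ ξ i}

/-- Symmetric norming (s.n.) functions on `ĉ`. -/
structure IsSNFunction (Φ : (ℕ →₀ ℝ) → ℝ) : Prop where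
  nonneg : ∀ ξ, 0 ≤ Φ ξ
  eq_zero : ∀ ξ, Φ ξ = 0 → ξ = 0
  smul : ∀ (c : ℝ) (ξ), Φ (c • ξ) = |c| * Φ ξ
  add_le : ∀ ξ η, Φ (ξ + η) ≤ Φ ξ + Φ η
  normalized : Φ (Finsupp.single 0 1) = 1
  symm : ∀ (n : ℕ) (σ : Equiv.Perm (Fin n)) (ξ η : ℕ →₀ ℝ),
    (∀ i, n ≤ i → ξ i = 0) → (∀ i, n ≤ i → η i = 0) →
    (∀ i : Fin n, η i = |ξ (σ i)|) → Φ ξ = Φ η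

/-- The nonincreasing rearrangement `η*` of `(|η i|)`. -/
noncomputable def decreasingRearrangement (η : ℕ →₀ ℝ) (i : ℕ) : ℝ :=
  ((η.support.val.map fun j => |η j|).sort (· ≥ ·)).getD i 0

/-- The adjoint `Φ*(η) = max { Φ(ξ)⁻¹ ∑ η*ᵢ ξᵢ : ξ ∈ k̂, ξ ≠ 0 }`. -/
noncomputable def snAdjoint (Φ : (ℕ →₀ ℝ) → ℝ) (η : ℕ →₀ ℝ) : ℝ :=
  sSup {r : ℝ | ∃ ξ ∈ decreasingCone, ξ ≠ 0 ∧
    r = (1 / Φ ξ) * ∑ i ∈ ξ.support, decreasingRearrangement η i * ξ i}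

/-- The 2-convexification `a ↦ Φ(a₁², a₂², …)^(1/2)`. -/
noncomputable def twoConvexification (Φ : (ℕ →₀ ℝ) → ℝ) (a : ℕ →₀ ℝ) : ℝ :=
  √(Φ (a.mapRange (fun t => t ^ 2) (by norm_num)))

/-- Q-norms: s.n. functions that are 2-convexifications of s.n. functions. -/
def IsQNorm (Φ : (ℕ →₀ ℝ) → ℝ) : Prop :=
  IsSNFunction Φ ∧ ∃ Υ, IsSNFunction Υ ∧ Φ = twoConvexification Υ

/-- Q*-norms: s.n. functions that are adjoints of Q-norms. -/
def IsQStarNorm (Φ : (ℕ →₀ ℝ) → ℝ) : Prop :=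
  IsSNFunction Φ ∧ ∃ Θ, IsQNorm Θ ∧ Φ = snAdjoint Θ

/-- The norm `‖x‖_Φ = Φ(s(x))` of a matrix, where `s(x)` is the sequence of singular numbers of
`x` in nonincreasing order, padded with zeros. -/
noncomputable def symmNorm (Φ : (ℕ →₀ ℝ) → ℝ) {n : ℕ} (x : Matrix (Fin n) (Fin n) ℂ) : ℝ :=
  Φ (Matrix.toEuclideanLin x).singularValues

/-! ### Operator spaces -/

/-- The matrix product `a x b` of a scalar matrix, a matrix over `E` and a scalar matrix. -/
def scalarSandwich {E : Type*} [AddCommGroup E] [Module ℂ E] {m n : ℕ}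
    (a : Matrix (Fin n) (Fin m) ℂ) (x : Matrix (Fin m) (Fin m) E)
    (b : Matrix (Fin m) (Fin n) ℂ) : Matrix (Fin n) (Fin n) E :=
  Matrix.of fun i j => ∑ k, ∑ l, (a i k * b l j) • x k l

/-- The block diagonal matrix `x ⊕ y`. -/
def blockDiag {E : Type*} [Zero E] {m n : ℕ} (x : Matrix (Fin m) (Fin m) E)
    (y : Matrix (Fin n) (Fin n) E) : Matrix (Fin (m + n)) (Fin (m + n)) E :=
  (Matrix.fromBlocks x 0 0 y).reindex finSumFinEquiv finSumFinEquiv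

/-- The operator norm of a scalar matrix acting between Euclidean spaces. -/
noncomputable def scalarOpNorm {m n : ℕ} (a : Matrix (Fin m) (Fin n) ℂ) : ℝ :=
  ‖(Matrix.toEuclideanLin a).toContinuousLinearMap‖

/-- A Banach space `E` with a family `N n` of functions on the spaces `Mₙ(E)` is an operator
space: each `N n` is a norm, `N 1` is the norm of `E`, and Ruan's axioms (M1), (M2) hold. -/
structure IsOperatorSpace {E : Type*} [NormedAddCommGroup E] [NormedSpace ℂ E] [CompleteSpace E]
    (N : ∀ n : ℕ, Matrix (Fin n) (Fin n) E → ℝ) : Prop where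
  nonneg : ∀ n x, 0 ≤ N n x
  eq_zero : ∀ n x, N n x = 0 → x = 0
  smul : ∀ n (c : ℂ) x, N n (c • x) = ‖c‖ * N n x
  add_le : ∀ n x y, N n (x + y) ≤ N n x + N n y
  norm_one : ∀ e : E, N 1 (Matrix.of fun _ _ => e) = ‖e‖
  M1 : ∀ (m n : ℕ) (x : Matrix (Fin m) (Fin m) E) (y : Matrix (Fin n) (Fin n) E),
    N (m + n) (blockDiag x y) = max (N m x) (N n y)
  M2 : ∀ (m n : ℕ) (a : Matrix (Fin n) (Fin m) ℂ) (x : Matrix (Fin m) (Fin m) E)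
    (b : Matrix (Fin m) (Fin n) ℂ),
    N n (scalarSandwich a x b) ≤ scalarOpNorm a * N m x * scalarOpNorm b

/-! ### The space `H(Φ, Ψ)` -/

section

variable {H : Type*} [NormedAddCommGroup H] [InnerProductSpace ℂ H]

/-- The map `ρ_T(x) = ∑ᵢ Tᵢ x Tᵢ*` for `T = ∑ᵢ ξᵢ ⊗ Tᵢ ∈ H ⊗ Mₙ = Mₙ(H)` (a finite sum, `ξᵢ`
orthonormal), written without a choice of the orthonormal family. It is given by the sum
above for every such expansion of `T` (`rhoMap_eq_sum`), and every `T` has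
such an expansion (`exists_orthonormal_expansion`). -/
noncomputable def rhoMap {n : ℕ} (T : Matrix (Fin n) (Fin n) H)
    (x : Matrix (Fin n) (Fin n) ℂ) : Matrix (Fin n) (Fin n) ℂ :=
  Matrix.of fun p q => ∑ r, ∑ s, inner ℂ (T q s) (T p r) * x r s

theorem rhoMap_eq_sum {n : ℕ} {ι : Type*} [Fintype ι] {ξ : ι → H} (hξ : Orthonormal ℂ ξ)
    (t : ι → Matrix (Fin n) (Fin n) ℂ) (x : Matrix (Fin n) (Fin n) ℂ) :
    rhoMap (Matrix.of fun p q => ∑ i, t i p q • ξ i) x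
      = ∑ i, t i * x * (t i).conjTranspose := by
  ext p q
  simp only [rhoMap, Matrix.of_apply, hξ.inner_sum, Matrix.sum_apply, Matrix.mul_apply,
    Matrix.conjTranspose_apply, Finset.sum_mul]
  rw [Finset.sum_comm]
  conv_lhs => enter [2, s]; rw [Finset.sum_comm]
  rw [Finset.sum_comm]
  refine Finset.sum_congr rfl fun i _ => Finset.sum_congr rfl fun s _ =>
    Finset.sum_congr rfl fun r _ => ?_
  simp only [starRingEnd_apply]
  ring

theorem exists_orthonormal_expansion {n : ℕ} (T : Matrix (Fin n) (Fin n) H) :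
    ∃ (k : ℕ) (ξ : Fin k → H) (t : Fin k → Matrix (Fin n) (Fin n) ℂ),
      Orthonormal ℂ ξ ∧ T = Matrix.of fun p q => ∑ i, t i p q • ξ i := by
  let S : Submodule ℂ H := Submodule.span ℂ (Set.range fun pq : Fin n × Fin n => T pq.1 pq.2)
  have : FiniteDimensional ℂ S := FiniteDimensional.span_of_finite ℂ (Set.finite_range _)
  have hT : ∀ p q, T p q ∈ S := fun p q => Submodule.subset_span ⟨(p, q), rfl⟩
  let b := stdOrthonormalBasis ℂ S
  refine ⟨_, fun i => (b i : H), fun i => Matrix.of fun p q => b.repr ⟨T p q, hT p q⟩ i,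
    b.orthonormal.comp_linearIsometry S.subtypeₗᵢ, ?_⟩
  ext p q
  have h := congrArg (fun v : S => (v : H)) (b.sum_repr ⟨T p q, hT p q⟩)
  simpa using h.symm

/-- The matrix norms of `H(Φ, Ψ)`: `‖T‖ = ‖ρ_T : 𝔖_Φ → 𝔖_Ψ‖^(1/2)` on `Mₙ(H) = H ⊗ Mₙ`. -/
noncomputable def hilbertNorm (H : Type*) [NormedAddCommGroup H] [InnerProductSpace ℂ H]
    (Φ Ψ : (ℕ →₀ ℝ) → ℝ) (n : ℕ) (T : Matrix (Fin n) (Fin n) H) : ℝ :=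
  √(sSup {r : ℝ | ∃ x : Matrix (Fin n) (Fin n) ℂ, symmNorm Φ x ≤ 1 ∧ r = symmNorm Ψ (rhoMap T x)})

end

/-! Write `ρ_{T,S}(x) = ∑ Tᵢ x Sᵢ*`, so that `ρ_{T+S}` is the sum of `ρ_T`, `ρ_{T,S}`, `ρ_{S,T}` and
`ρ_S`. The triangle inequality reduces to a Cauchy–Schwarz estimate (`symmNorm_rhoMap₂_le`):
`‖ρ_{T,S}‖` is at most the product of the norms of `T` and `S`. It is proved by diagonalizing both
`x` and `ρ_{T,S}(x)`, after which the singular values of `ρ_{T,S}(x)` are weighted sums of inner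
products in `H`. Axiom (M2) follows from `ρ_{aTb}(x) = a ρ_T(b x b*) a*` and the ideal property of
symmetric norms. These arguments use only that `Φ` and `Ψ` are s.n. functions with `Ψ ≤ Φ`.

The Q-hypotheses enter in `Ψ ≤ Φ` and in (M1). A Q-norm is at most the `ℓ²` norm, and by duality a
Q*-norm is at least the `ℓ²` norm. For (M1), `‖y‖_Ψ²` is an s.n. function of the squared singular
values of `y`, so cutting `y` into blocks gives `‖y‖_Ψ² ≤ ∑ ‖blocks‖_Ψ²` (`IsQNorm.symmNorm_sq_le`).
Trace duality reverses the inequality for Q*-norms (`IsQStarNorm.add_sq_le`). Since `ρ_{T⊕S}` sends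
each of the four blocks of `x` to the block in the same place, by one of the four maps above, the
blockwise bounds add up in squares (`hilbertNorm_add_le_max`).

Facts about matrix norms are pulled back to sequences by one principle: the diagonal of `P x Q`,
with `P` and `Q` contractions, has s.n. value at most `‖x‖_Φ`, and suitable unitaries attain it. It
rests on s.n. functions decreasing under doubly substochastic matrices. -/

/-! ### Symmetric norming functions of finite families -/

section FiniteFamilies

variable {ι κ : Type*} [Fintype ι] [Fintype κ]

/-- The finitely supported sequence carrying the finite family `v` along the embedding `e`. -/
noncomputable def toSeq (e : ι ↪ ℕ) (v : ι → ℝ) : ℕ →₀ ℝ :=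
  (Finsupp.equivFunOnFinite.symm v).embDomain e

theorem toSeq_apply (e : ι ↪ ℕ) (v : ι → ℝ) (i : ι) : toSeq e v (e i) = v i := by
  simp [toSeq]

theorem toSeq_of_notMem (e : ι ↪ ℕ) (v : ι → ℝ) {k : ℕ} (hk : k ∉ Set.range e) :
    toSeq e v k = 0 :=
  Finsupp.embDomain_of_notMem_range _ _ _ hk

theorem eq_toSeq (e : ι ↪ ℕ) {ξ : ℕ →₀ ℝ} {v : ι → ℝ} (h : ∀ i, ξ (e i) = v i)
    (h0 : ∀ k ∉ Set.range e, ξ k = 0) : ξ = toSeq e v := by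
  ext k
  by_cases hk : k ∈ Set.range e
  · obtain ⟨i, rfl⟩ := hk
    rw [h, toSeq_apply]
  · rw [h0 k hk, toSeq_of_notMem e v hk]

/-- A finite type is embedded into `ℕ`. -/
noncomputable def natEmbedding (ι : Type*) [Fintype ι] : ι ↪ ℕ :=
  (Fintype.equivFin ι).toEmbedding.trans Fin.valEmbedding

/-- The value of a function of finitely supported sequences at a finite family. -/
noncomputable def snFun (Φ : (ℕ →₀ ℝ) → ℝ) (v : ι → ℝ) : ℝ := Φ (toSeq (natEmbedding ι) v)

variable {Φ : (ℕ →₀ ℝ) → ℝ}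

/-- Symmetry is only given for permutations of an initial segment, so both embeddings are put into a
common `Fin N`, and the bijection between their ranges is extended to a permutation of `Fin N`. -/
theorem IsSNFunction.toSeq_abs (hΦ : IsSNFunction Φ) (e e' : ι ↪ ℕ) (v : ι → ℝ) :
    Φ (toSeq e v) = Φ (toSeq e' fun i => |v i|) := by
  classical
  obtain ⟨N, hN⟩ : ∃ N, ∀ i, e i < N ∧ e' i < N := by
    refine ⟨∑ i, (e i + e' i) + 1, fun i => ?_⟩
    have := Finset.single_le_sum (f := fun i => e i + e' i) (fun _ _ => Nat.zero_le _)
      (Finset.mem_univ i)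
    grind
  let f : ι → Fin N := fun i => ⟨e i, (hN i).1⟩
  let f' : ι → Fin N := fun i => ⟨e' i, (hN i).2⟩
  have hf : Function.Injective f := fun i j h => e.injective (Fin.val_eq_of_eq h)
  have hf' : Function.Injective f' := fun i j h => e'.injective (Fin.val_eq_of_eq h)
  let τ : {x // x ∈ Set.range f'} ≃ {x // x ∈ Set.range f} :=
    (Equiv.ofInjective f' hf').symm.trans (Equiv.ofInjective f hf)
  have hτ : ∀ i, τ.extendSubtype (f' i) = f i := fun i => by
    rw [Equiv.extendSubtype_apply_of_mem _ _ ⟨i, rfl⟩]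
    simp [τ, Equiv.ofInjective_symm_apply hf' i]
  refine hΦ.symm N τ.extendSubtype _ _ ?_ ?_ fun k => ?_
  · intro k hk
    exact toSeq_of_notMem _ _ (by rintro ⟨i, rfl⟩; have := hN i; omega)
  · intro k hk
    exact toSeq_of_notMem _ _ (by rintro ⟨i, rfl⟩; have := hN i; omega)
  · by_cases hk : k ∈ Set.range f'
    · obtain ⟨i, rfl⟩ := hk
      rw [hτ]
      exact (toSeq_apply e' (fun i => |v i|) i).trans (congrArg abs (toSeq_apply e v i).symm)
    · have h := Equiv.extendSubtype_not_mem τ k hk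
      rw [toSeq_of_notMem, toSeq_of_notMem, abs_zero]
      · rintro ⟨i, hi⟩
        exact h ⟨i, Fin.ext hi⟩
      · rintro ⟨i, hi⟩
        exact hk ⟨i, Fin.ext hi⟩

theorem IsSNFunction.toSeq_eq (hΦ : IsSNFunction Φ) (e : ι ↪ ℕ) (v : ι → ℝ) :
    Φ (toSeq e v) = snFun Φ v := by
  rw [hΦ.toSeq_abs e e, snFun, hΦ.toSeq_abs (natEmbedding ι) e]

theorem IsSNFunction.snFun_congr_abs (hΦ : IsSNFunction Φ) {v w : ι → ℝ}
    (h : ∀ i, |v i| = |w i|) : snFun Φ v = snFun Φ w := by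
  rw [snFun, hΦ.toSeq_abs (natEmbedding ι) (natEmbedding ι) v, snFun,
    hΦ.toSeq_abs (natEmbedding ι) (natEmbedding ι) w]
  simp only [h]

theorem IsSNFunction.snFun_comp_embedding (hΦ : IsSNFunction Φ) (f : ι ↪ κ) (v : κ → ℝ)
    (hv : ∀ k ∉ Set.range f, v k = 0) : snFun Φ (v ∘ f) = snFun Φ v := by
  rw [← hΦ.toSeq_eq (f.trans (natEmbedding κ)), snFun]
  congr 1
  refine (eq_toSeq _ (fun i => toSeq_apply (natEmbedding κ) v (f i)) fun k hk => ?_).symm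
  by_cases h : k ∈ Set.range (natEmbedding κ)
  · obtain ⟨j, rfl⟩ := h
    rw [toSeq_apply]
    exact hv j fun ⟨i, hi⟩ => hk ⟨i, by simp [hi]⟩
  · exact toSeq_of_notMem _ _ h

theorem IsSNFunction.snFun_comp_equiv (hΦ : IsSNFunction Φ) (σ : ι ≃ κ) (v : κ → ℝ) :
    snFun Φ (v ∘ σ) = snFun Φ v :=
  hΦ.snFun_comp_embedding σ.toEmbedding v fun k hk => (hk ⟨σ.symm k, by simp⟩).elim

theorem IsSNFunction.snFun_nonneg (hΦ : IsSNFunction Φ) (v : ι → ℝ) : 0 ≤ snFun Φ v :=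
  hΦ.nonneg _

theorem IsSNFunction.snFun_smul (hΦ : IsSNFunction Φ) (c : ℝ) (v : ι → ℝ) :
    snFun Φ (c • v) = |c| * snFun Φ v := by
  rw [snFun, snFun, ← hΦ.smul]
  congr 1
  refine (eq_toSeq _ (fun i => ?_) fun k hk => ?_).symm
  · simp [toSeq_apply]
  · simp [toSeq_of_notMem _ _ hk]

theorem IsSNFunction.snFun_add_le (hΦ : IsSNFunction Φ) (v w : ι → ℝ) :
    snFun Φ (v + w) ≤ snFun Φ v + snFun Φ w := by
  refine le_trans (le_of_eq ?_) (hΦ.add_le _ _)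
  rw [snFun]
  congr 1
  refine (eq_toSeq _ (fun i => ?_) fun k hk => ?_).symm
  · simp [toSeq_apply]
  · simp [toSeq_of_notMem _ _ hk]

theorem IsSNFunction.snFun_zero (hΦ : IsSNFunction Φ) : snFun Φ (0 : ι → ℝ) = 0 := by
  simpa using hΦ.snFun_smul 0 (0 : ι → ℝ)

theorem IsSNFunction.snFun_sum_le (hΦ : IsSNFunction Φ) {α : Type*} (s : Finset α)
    (v : α → ι → ℝ) : snFun Φ (∑ a ∈ s, v a) ≤ ∑ a ∈ s, snFun Φ (v a) := by
  classical
  induction s using Finset.induction_on with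
  | empty => simp [hΦ.snFun_zero]
  | insert a s ha ih =>
    rw [Finset.sum_insert ha, Finset.sum_insert ha]
    exact (hΦ.snFun_add_le _ _).trans (by gcongr)

theorem IsSNFunction.snFun_single (hΦ : IsSNFunction Φ) [DecidableEq ι] (i : ι) (c : ℝ) :
    snFun Φ (Pi.single i c) = |c| := by
  rw [← mul_one |c|, ← hΦ.normalized, ← hΦ.smul]
  have h := hΦ.snFun_comp_embedding ⟨fun _ : Unit => i, fun _ _ _ => rfl⟩ (Pi.single i c)
    fun k hk => Pi.single_eq_of_ne (fun h => hk ⟨(), h.symm⟩) _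
  rw [← h, ← hΦ.toSeq_eq ⟨fun _ => 0, fun _ _ _ => rfl⟩]
  congr 1
  refine (eq_toSeq _ (fun j => ?_) fun k hk => ?_).symm
  · exact (by simp : (c • Finsupp.single 0 (1 : ℝ)) 0 = Pi.single (M := fun _ => ℝ) i c i)
  · have : k ≠ 0 := fun h => hk ⟨(), h.symm⟩
    simp [this]

theorem IsSNFunction.snFun_le_sum (hΦ : IsSNFunction Φ) (v : ι → ℝ) :
    snFun Φ v ≤ ∑ i, |v i| := by
  classical
  calc snFun Φ v = snFun Φ (∑ i, Pi.single i (v i)) := by rw [Finset.univ_sum_single]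
    _ ≤ ∑ i, snFun Φ (Pi.single i (v i)) := hΦ.snFun_sum_le _ _
    _ = ∑ i, |v i| := by simp [hΦ.snFun_single]

/-- Averaging `v` with its sign flip on the second block kills that block and keeps the first, and
the flip does not change the s.n. value. -/
theorem IsSNFunction.snFun_inl_le (hΦ : IsSNFunction Φ) (v : ι ⊕ κ → ℝ) :
    snFun Φ (v ∘ Sum.inl) ≤ snFun Φ v := by
  let w : ι ⊕ κ → ℝ := Sum.elim (v ∘ Sum.inl) (-(v ∘ Sum.inr))
  have hw : snFun Φ w = snFun Φ v := hΦ.snFun_congr_abs (by rintro (i | i) <;> simp [w])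
  have h1 : snFun Φ (v ∘ Sum.inl) = snFun Φ ((2⁻¹ : ℝ) • (v + w)) := by
    rw [← hΦ.snFun_comp_embedding Function.Embedding.inl ((2⁻¹ : ℝ) • (v + w))]
    · congr 1
      ext i
      simp only [Function.comp_apply, Function.Embedding.inl_apply, Pi.smul_apply, Pi.add_apply,
        smul_eq_mul, w, Sum.elim_inl]
      ring
    · rintro (k | k) hk
      · exact (hk ⟨k, rfl⟩).elim
      · simp [w]
  rw [h1, hΦ.snFun_smul, abs_of_pos (by norm_num)]
  linarith [hΦ.snFun_add_le v w]

/-- By Birkhoff's theorem `M` is a convex combination of permutation matrices, each of which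
preserves `snFun Φ`. -/
theorem IsSNFunction.snFun_mulVec_le_of_doublyStochastic (hΦ : IsSNFunction Φ) [DecidableEq ι]
    {M : Matrix ι ι ℝ} (hM : M ∈ doublyStochastic ℝ ι) (v : ι → ℝ) :
    snFun Φ (M.mulVec v) ≤ snFun Φ v := by
  obtain ⟨w, hw, hw1, rfl⟩ := exists_eq_sum_perm_of_mem_doublyStochastic hM
  calc snFun Φ ((∑ σ, w σ • σ.permMatrix ℝ).mulVec v)
      = snFun Φ (∑ σ : Equiv.Perm ι, w σ • (v ∘ σ)) := by
        congr 1
        rw [Matrix.sum_mulVec]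
        exact Finset.sum_congr rfl fun σ _ => by
          rw [Matrix.smul_mulVec, Matrix.permMatrix_mulVec]
    _ ≤ ∑ σ : Equiv.Perm ι, snFun Φ (w σ • (v ∘ σ)) := hΦ.snFun_sum_le _ _
    _ = snFun Φ v := by
        simp only [hΦ.snFun_smul, hΦ.snFun_comp_equiv, abs_of_nonneg (hw _)]
        rw [← Finset.sum_mul, hw1, one_mul]

theorem IsSNFunction.snFun_mulVec_le (hΦ : IsSNFunction Φ) {M : Matrix ι κ ℝ}
    (h0 : ∀ i j, 0 ≤ M i j) (hr : ∀ i, ∑ j, M i j ≤ 1) (hc : ∀ j, ∑ i, M i j ≤ 1)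
    (v : κ → ℝ) : snFun Φ (M.mulVec v) ≤ snFun Φ v := by
  classical
  -- A doubly stochastic dilation of `M`: the missing row and column masses go on the diagonal, and
  -- `Mᵀ` balances the other corner. Applied to `(0, v)`, its first block is `M v`.
  let D : Matrix (ι ⊕ κ) (ι ⊕ κ) ℝ := Matrix.fromBlocks
    (Matrix.diagonal fun i => 1 - ∑ j, M i j) M M.transpose
    (Matrix.diagonal fun j => 1 - ∑ i, M i j)
  have hD : D ∈ doublyStochastic ℝ (ι ⊕ κ) := by
    rw [mem_doublyStochastic_iff_sum]
    refine ⟨?_, ?_, ?_⟩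
    · rintro (i | i) (j | j)
      · simp only [D, Matrix.fromBlocks_apply₁₁, Matrix.diagonal_apply]
        split_ifs <;> simp [hr]
      · exact h0 _ _
      · exact h0 _ _
      · simp only [D, Matrix.fromBlocks_apply₂₂, Matrix.diagonal_apply]
        split_ifs <;> simp [hc]
    · rintro (i | i) <;> simp [D, Matrix.diagonal_apply]
    · rintro (i | i) <;> simp [D, Matrix.diagonal_apply]
  let u : ι ⊕ κ → ℝ := Sum.elim 0 v
  calc snFun Φ (M.mulVec v) = snFun Φ (D.mulVec u ∘ Sum.inl) := by
        congr 1
        ext i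
        simp [D, u, Matrix.fromBlocks_mulVec]
    _ ≤ snFun Φ (D.mulVec u) := hΦ.snFun_inl_le _
    _ ≤ snFun Φ u := hΦ.snFun_mulVec_le_of_doublyStochastic hD u
    _ = snFun Φ (u ∘ Function.Embedding.inr) := by
        refine (hΦ.snFun_comp_embedding _ _ ?_).symm
        rintro (k | k) hk
        · rfl
        · exact (hk ⟨k, rfl⟩).elim

theorem IsSNFunction.snFun_mono (hΦ : IsSNFunction Φ) {v w : ι → ℝ} (h : ∀ i, |v i| ≤ |w i|) :
    snFun Φ v ≤ snFun Φ w := by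
  classical
  -- Where `w i = 0` also `v i = 0`, so the convention `0 / 0 = 0` is harmless.
  let c : ι → ℝ := fun i => |v i| / |w i|
  have hc1 : ∀ i, c i ≤ 1 := fun i => div_le_one_of_le₀ (h i) (abs_nonneg _)
  have hc0 : ∀ i, 0 ≤ c i := fun i => by positivity
  have := hΦ.snFun_mulVec_le (M := Matrix.diagonal c) (fun i j => by
    rw [Matrix.diagonal_apply]; split_ifs <;> simp [hc0]) (by simpa [Matrix.diagonal_apply])
    (by simpa [Matrix.diagonal_apply]) w
  refine le_trans (le_of_eq (hΦ.snFun_congr_abs fun i => ?_)) this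
  rw [Matrix.mulVec_diagonal, abs_mul, abs_of_nonneg (hc0 i)]
  by_cases hw : w i = 0
  · have := h i
    simp_all
  · exact (div_mul_cancel₀ _ (abs_ne_zero.2 hw)).symm

/-- Symmetric norming functions decrease under doubly substochastic matrices. -/
theorem IsSNFunction.snFun_le_of_substochastic (hΦ : IsSNFunction Φ) (M : ι → κ → ℝ)
    (h0 : ∀ i j, 0 ≤ M i j) (hr : ∀ i, ∑ j, M i j ≤ 1) (hc : ∀ j, ∑ i, M i j ≤ 1)
    {w : ι → ℝ} {v : κ → ℝ} (h : ∀ i, |w i| ≤ ∑ j, M i j * |v j|) :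
    snFun Φ w ≤ snFun Φ v := by
  calc snFun Φ w ≤ snFun Φ ((Matrix.of M).mulVec fun j => |v j|) :=
        hΦ.snFun_mono fun i => (h i).trans (le_abs_self _)
    _ ≤ snFun Φ (fun j => |v j|) := hΦ.snFun_mulVec_le h0 hr hc _
    _ = snFun Φ v := hΦ.snFun_congr_abs (by simp)

theorem IsSNFunction.abs_le_snFun (hΦ : IsSNFunction Φ) (v : ι → ℝ) (i : ι) :
    |v i| ≤ snFun Φ v := by
  classical
  rw [← hΦ.snFun_single i]
  refine hΦ.snFun_mono fun j => ?_
  by_cases h : j = i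
  · subst h; simp
  · simp [h]

end FiniteFamilies

/-! ### Symmetric norms of matrices -/

open scoped Matrix.Norms.L2Operator

section Matrices

variable {n m : ℕ}

theorem sum_col_norm_sq_le (a : Matrix (Fin m) (Fin n) ℂ) (j : Fin n) :
    ∑ i, ‖a i j‖ ^ 2 ≤ ‖a‖ ^ 2 := by
  have h := Matrix.l2_opNorm_mulVec a (EuclideanSpace.single j 1)
  rw [PiLp.norm_single, norm_one, mul_one] at h
  have h2 := pow_le_pow_left₀ (norm_nonneg _) h 2
  rw [EuclideanSpace.norm_sq_eq] at h2
  simpa using h2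

theorem sum_row_norm_sq_le (a : Matrix (Fin m) (Fin n) ℂ) (i : Fin m) :
    ∑ j, ‖a i j‖ ^ 2 ≤ ‖a‖ ^ 2 := by
  have h := sum_col_norm_sq_le a.conjTranspose i
  rw [Matrix.l2_opNorm_conjTranspose] at h
  simpa using h

theorem norm_le_one_of_conjTranspose_mul_self {a : Matrix (Fin m) (Fin n) ℂ}
    (h : a.conjTranspose * a = 1) : ‖a‖ ≤ 1 := by
  rcases isEmpty_or_nonempty (Fin n) with hn | hn
  · have : a = 0 := by ext i j; exact hn.elim j
    simp [this]
  · have h1 := Matrix.l2_opNorm_conjTranspose_mul_self a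
    rw [h, norm_one] at h1
    nlinarith [norm_nonneg a]

theorem norm_le_one_of_mem_unitary {U : Matrix (Fin n) (Fin n) ℂ}
    (hU : U ∈ Matrix.unitaryGroup (Fin n) ℂ) : ‖U‖ ≤ 1 :=
  norm_le_one_of_conjTranspose_mul_self (Matrix.mem_unitaryGroup_iff'.1 hU)

/-! ### Singular values and compressions -/

/-- The singular values of a square matrix, in nonincreasing order. -/
noncomputable def sv (x : Matrix (Fin n) (Fin n) ℂ) (i : Fin n) : ℝ :=
  (Matrix.toEuclideanLin x).singularValues i

theorem sv_nonneg (x : Matrix (Fin n) (Fin n) ℂ) (i : Fin n) : 0 ≤ sv x i :=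
  LinearMap.singularValues_nonneg _ _

theorem singularValues_eq_toSeq (x : Matrix (Fin n) (Fin n) ℂ) :
    (Matrix.toEuclideanLin x).singularValues = toSeq Fin.valEmbedding (sv x) := by
  refine eq_toSeq _ (fun i => rfl) fun k hk => LinearMap.singularValues_of_finrank_le _ ?_
  by_contra h
  simp at h
  exact hk ⟨⟨k, h⟩, rfl⟩

theorem IsSNFunction.symmNorm_eq {Φ : (ℕ →₀ ℝ) → ℝ} (hΦ : IsSNFunction Φ)
    (x : Matrix (Fin n) (Fin n) ℂ) : symmNorm Φ x = snFun Φ (sv x) := by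
  rw [symmNorm, singularValues_eq_toSeq, hΦ.toSeq_eq]

/-- The singular value decomposition. -/
theorem exists_svd (x : Matrix (Fin n) (Fin n) ℂ) :
    ∃ U ∈ Matrix.unitaryGroup (Fin n) ℂ, ∃ V ∈ Matrix.unitaryGroup (Fin n) ℂ,
      x = U * Matrix.diagonal (fun i => (sv x i : ℂ)) * V := by
  classical
  let T := Matrix.toEuclideanLin x
  have hn : Module.finrank ℂ (EuclideanSpace ℂ (Fin n)) = n := by simp
  let b := T.isSymmetric_adjoint_comp_self.eigenvectorBasis hn
  have hT : ∀ i j, inner ℂ (T (b i)) (T (b j)) = if i = j then ((sv x j : ℂ)) ^ 2 else 0 := by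
    intro i j
    have h1 := T.isSymmetric_adjoint_comp_self.apply_eigenvectorBasis hn j
    rw [← LinearMap.adjoint_inner_right]
    rw [LinearMap.comp_apply] at h1
    rw [h1, ← T.sq_singularValues_fin hn, inner_smul_right, orthonormal_iff_ite.1 b.orthonormal i j]
    simp [sv, T]
  have hT0 : ∀ j, sv x j = 0 → T (b j) = 0 := fun j hj => by
    have := hT j j
    rw [if_pos rfl, hj] at this
    simpa using this
  let s : Set (Fin n) := {i | sv x i ≠ 0}
  -- The images of the eigenbasis of `T* T` are orthogonal with lengths the singular values. Only
  -- the nonzero ones can be normalized; the rest of `u` is an arbitrary orthonormal completion.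
  obtain ⟨u, hu⟩ := Orthonormal.exists_orthonormalBasis_extension_of_card_eq (𝕜 := ℂ)
    (E := EuclideanSpace ℂ (Fin n)) (ι := Fin n) (by simp)
    (v := fun i => ((sv x i : ℂ))⁻¹ • T (b i)) (s := s) (by
      rw [orthonormal_iff_ite]
      rintro ⟨i, hi⟩ ⟨j, hj⟩
      have hj' : (sv x j : ℂ) ≠ 0 := by exact_mod_cast hj
      simp only [Set.domRestrict_apply, inner_smul_left, inner_smul_right, hT, Subtype.mk.injEq]
      split_ifs with h
      · subst h
        simp
        field_simp
      · simp)
  have hTu : ∀ j, T (b j) = (sv x j : ℂ) • u j := fun j => by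
    by_cases hj : sv x j = 0
    · rw [hT0 j hj, hj]; simp
    · have hj' : (sv x j : ℂ) ≠ 0 := by exact_mod_cast hj
      rw [hu j hj, smul_inv_smul₀ hj']
  let U : Matrix (Fin n) (Fin n) ℂ := Matrix.of fun i j => u j i
  let W : Matrix (Fin n) (Fin n) ℂ := Matrix.of fun i j => b j i
  have hU : U ∈ Matrix.unitaryGroup (Fin n) ℂ := by
    rw [Matrix.mem_unitaryGroup_iff']
    ext i j
    have := orthonormal_iff_ite.1 u.orthonormal i j
    rw [PiLp.inner_apply] at this
    rw [Matrix.mul_apply, Matrix.one_apply, ← this]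
    simp [U, Matrix.star_apply, mul_comm]
  have hW : W ∈ Matrix.unitaryGroup (Fin n) ℂ := by
    rw [Matrix.mem_unitaryGroup_iff']
    ext i j
    have := orthonormal_iff_ite.1 b.orthonormal i j
    rw [PiLp.inner_apply] at this
    rw [Matrix.mul_apply, Matrix.one_apply, ← this]
    simp [W, Matrix.star_apply, mul_comm]
  have hxW : x * W = U * Matrix.diagonal (fun i => (sv x i : ℂ)) := by
    ext i j
    have := congrArg (fun v : EuclideanSpace ℂ (Fin n) => v i) (hTu j)
    rw [Matrix.mul_diagonal, Matrix.mul_apply]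
    simpa [T, Matrix.mulVec, dotProduct, U, W, mul_comm] using this
  refine ⟨U, hU, star W, Unitary.star_mem hW, ?_⟩
  rw [← hxW, mul_assoc, Matrix.mem_unitaryGroup_iff.1 hW, mul_one]

variable {Φ : (ℕ →₀ ℝ) → ℝ}

/-- The diagonal entries are dominated by the matrix `‖P k j‖ * ‖Q j k‖` applied to `|d|`. It is
doubly substochastic because rows and columns of a contraction have `ℓ²` norm at most one. -/
theorem IsSNFunction.snFun_mul_mul_diagonal_le (hΦ : IsSNFunction Φ)
    (P : Matrix (Fin n) (Fin m) ℂ) (d : Fin m → ℝ) (Q : Matrix (Fin m) (Fin n) ℂ)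
    (hP : ‖P‖ ≤ 1) (hQ : ‖Q‖ ≤ 1) :
    snFun Φ (fun k => ‖(P * Matrix.diagonal (fun i => (d i : ℂ)) * Q) k k‖) ≤ snFun Φ d := by
  have key : ∀ {p : ℕ} (f g : Fin p → ℝ), ∑ i, f i ^ 2 ≤ 1 → ∑ i, g i ^ 2 ≤ 1 →
      ∑ i, f i * g i ≤ 1 := by
    intro p f g hf hg
    calc ∑ i, f i * g i ≤ ∑ i, (f i ^ 2 + g i ^ 2) / 2 :=
          Finset.sum_le_sum fun i _ => by nlinarith [sq_nonneg (f i - g i)]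
      _ = (∑ i, f i ^ 2 + ∑ i, g i ^ 2) / 2 := by
          rw [← Finset.sum_div, Finset.sum_add_distrib]
      _ ≤ 1 := by linarith
  have hP2 : ‖P‖ ^ 2 ≤ 1 := pow_le_one₀ (norm_nonneg _) hP
  have hQ2 : ‖Q‖ ^ 2 ≤ 1 := pow_le_one₀ (norm_nonneg _) hQ
  refine hΦ.snFun_le_of_substochastic (fun k j => ‖P k j‖ * ‖Q j k‖)
    (fun _ _ => by positivity) (fun k => ?_) (fun j => ?_) fun k => ?_
  · exact key _ _ ((sum_row_norm_sq_le P k).trans hP2) ((sum_col_norm_sq_le Q k).trans hQ2)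
  · exact key _ _ ((sum_col_norm_sq_le P j).trans hP2) ((sum_row_norm_sq_le Q j).trans hQ2)
  · rw [abs_norm, Matrix.mul_apply]
    refine (norm_sum_le _ _).trans (Finset.sum_le_sum fun j _ => le_of_eq ?_)
    rw [Matrix.mul_diagonal, norm_mul, norm_mul, Complex.norm_real, Real.norm_eq_abs]
    ring

/-- The diagonal of a compression of `x` has smaller norm than `x`. -/
theorem IsSNFunction.snFun_diag_le (hΦ : IsSNFunction Φ)
    (P : Matrix (Fin n) (Fin m) ℂ) (x : Matrix (Fin m) (Fin m) ℂ) (Q : Matrix (Fin m) (Fin n) ℂ)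
    (hP : ‖P‖ ≤ 1) (hQ : ‖Q‖ ≤ 1) :
    snFun Φ (fun k => ‖(P * x * Q) k k‖) ≤ symmNorm Φ x := by
  obtain ⟨U, hU, V, hV, h⟩ := exists_svd x
  rw [hΦ.symmNorm_eq]
  refine le_trans (le_of_eq ?_) (hΦ.snFun_mul_mul_diagonal_le (P * U) (sv x) (V * Q) ?_ ?_)
  · conv_lhs => rw [h]
    simp only [mul_assoc, Matrix.mul_assoc]
  · exact (Matrix.l2_opNorm_mul _ _).trans
      (mul_le_one₀ hP (norm_nonneg _) (norm_le_one_of_mem_unitary hU))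
  · exact (Matrix.l2_opNorm_mul _ _).trans
      (mul_le_one₀ (norm_le_one_of_mem_unitary hV) (norm_nonneg _) hQ)

/-- The singular values of `x` are the diagonal of a compression of `x`. -/
theorem exists_sv_eq_diag (x : Matrix (Fin n) (Fin n) ℂ) :
    ∃ P Q : Matrix (Fin n) (Fin n) ℂ, P ∈ Matrix.unitaryGroup (Fin n) ℂ ∧
      Q ∈ Matrix.unitaryGroup (Fin n) ℂ ∧
      P * x * Q = Matrix.diagonal (fun i => (sv x i : ℂ)) := by
  obtain ⟨U, hU, V, hV, h⟩ := exists_svd x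
  refine ⟨star U, star V, Unitary.star_mem hU, Unitary.star_mem hV, ?_⟩
  conv_lhs => rw [h]
  rw [mul_assoc, mul_assoc, mul_assoc, Matrix.mem_unitaryGroup_iff.1 hV, mul_one, ← mul_assoc,
    Matrix.mem_unitaryGroup_iff'.1 hU, one_mul]

/-! ### Norm axioms, ideal property and adjoint invariance of symmetric norms -/

theorem IsSNFunction.symmNorm_nonneg (hΦ : IsSNFunction Φ) (x : Matrix (Fin n) (Fin n) ℂ) :
    0 ≤ symmNorm Φ x := hΦ.nonneg _

theorem IsSNFunction.symmNorm_zero (hΦ : IsSNFunction Φ) :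
    symmNorm Φ (0 : Matrix (Fin n) (Fin n) ℂ) = 0 := by
  have h := hΦ.smul 0 0
  simp only [zero_smul, abs_zero, zero_mul] at h
  simp [symmNorm, h]

theorem IsSNFunction.symmNorm_eq_zero (hΦ : IsSNFunction Φ) {x : Matrix (Fin n) (Fin n) ℂ}
    (h : symmNorm Φ x = 0) : x = 0 := by
  have := hΦ.eq_zero _ h
  simpa using this

theorem IsSNFunction.symmNorm_mul_mul_le_of_norm_le_one (hΦ : IsSNFunction Φ)
    (a : Matrix (Fin n) (Fin m) ℂ) (x : Matrix (Fin m) (Fin m) ℂ) (b : Matrix (Fin m) (Fin n) ℂ)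
    (ha : ‖a‖ ≤ 1) (hb : ‖b‖ ≤ 1) : symmNorm Φ (a * x * b) ≤ symmNorm Φ x := by
  obtain ⟨P, Q, hP, hQ, h⟩ := exists_sv_eq_diag (a * x * b)
  have h1 := hΦ.snFun_diag_le (P * a) x (b * Q)
    ((Matrix.l2_opNorm_mul _ _).trans
      (mul_le_one₀ (norm_le_one_of_mem_unitary hP) (norm_nonneg _) ha))
    ((Matrix.l2_opNorm_mul _ _).trans
      (mul_le_one₀ hb (norm_nonneg _) (norm_le_one_of_mem_unitary hQ)))
  have h2 : P * a * x * (b * Q) = Matrix.diagonal (fun i => (sv (a * x * b) i : ℂ)) := by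
    rw [← h]
    simp only [Matrix.mul_assoc]
  rw [hΦ.symmNorm_eq]
  refine le_trans (le_of_eq (hΦ.snFun_congr_abs fun k => ?_)) h1
  simp [h2]

/-- Singular values are not subadditive termwise, but those of `x + y` form the diagonal of `P * (x
+ y) * Q` for fixed unitaries, and diagonals are additive. -/
theorem IsSNFunction.symmNorm_add_le (hΦ : IsSNFunction Φ) (x y : Matrix (Fin n) (Fin n) ℂ) :
    symmNorm Φ (x + y) ≤ symmNorm Φ x + symmNorm Φ y := by
  obtain ⟨P, Q, hP, hQ, h⟩ := exists_sv_eq_diag (x + y)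
  have hP' := norm_le_one_of_mem_unitary hP
  have hQ' := norm_le_one_of_mem_unitary hQ
  rw [hΦ.symmNorm_eq (x + y)]
  refine le_trans (le_trans (hΦ.snFun_mono fun k => ?_) (hΦ.snFun_add_le _ _))
    (add_le_add (hΦ.snFun_diag_le P x Q hP' hQ') (hΦ.snFun_diag_le P y Q hP' hQ'))
  have h2 : ((sv (x + y) k : ℂ)) = (P * x * Q) k k + (P * y * Q) k k := by
    rw [← Matrix.add_apply, ← add_mul, ← mul_add, h, Matrix.diagonal_apply_eq]
  rw [Pi.add_apply, abs_of_nonneg (by positivity : 0 ≤ ‖(P * x * Q) k k‖ + ‖(P * y * Q) k k‖)]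
  rw [← Real.norm_eq_abs, ← Complex.norm_real, h2]
  exact norm_add_le _ _

theorem IsSNFunction.symmNorm_smul_le (hΦ : IsSNFunction Φ) (c : ℂ)
    (x : Matrix (Fin n) (Fin n) ℂ) : symmNorm Φ (c • x) ≤ ‖c‖ * symmNorm Φ x := by
  obtain ⟨P, Q, hP, hQ, h⟩ := exists_sv_eq_diag (c • x)
  have h1 := hΦ.snFun_diag_le P x Q (norm_le_one_of_mem_unitary hP) (norm_le_one_of_mem_unitary hQ)
  calc symmNorm Φ (c • x) = snFun Φ (‖c‖ • fun k => ‖(P * x * Q) k k‖) := by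
        rw [hΦ.symmNorm_eq]
        refine hΦ.snFun_congr_abs fun k => ?_
        rw [← Real.norm_eq_abs, ← Complex.norm_real, ← Matrix.diagonal_apply_eq
          (fun i => (sv (c • x) i : ℂ)), ← h, Matrix.mul_smul, Matrix.smul_mul]
        simp
    _ ≤ ‖c‖ * symmNorm Φ x := by
        rw [hΦ.snFun_smul, abs_norm]
        gcongr

theorem IsSNFunction.symmNorm_smul (hΦ : IsSNFunction Φ) (c : ℂ)
    (x : Matrix (Fin n) (Fin n) ℂ) : symmNorm Φ (c • x) = ‖c‖ * symmNorm Φ x := by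
  refine le_antisymm (hΦ.symmNorm_smul_le c x) ?_
  by_cases hc : c = 0
  · subst hc; simpa using hΦ.symmNorm_nonneg _
  · have h := hΦ.symmNorm_smul_le c⁻¹ (c • x)
    rw [inv_smul_smul₀ hc, norm_inv] at h
    rwa [le_inv_mul_iff₀ (norm_pos_iff.2 hc)] at h

theorem IsSNFunction.symmNorm_sum_le (hΦ : IsSNFunction Φ) {α : Type*} (s : Finset α)
    (x : α → Matrix (Fin n) (Fin n) ℂ) : symmNorm Φ (∑ a ∈ s, x a) ≤ ∑ a ∈ s, symmNorm Φ (x a) := by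
  classical
  induction s using Finset.induction_on with
  | empty => simp [hΦ.symmNorm_zero]
  | insert a s ha ih =>
    rw [Finset.sum_insert ha, Finset.sum_insert ha]
    exact (hΦ.symmNorm_add_le _ _).trans (by gcongr)

/-- The ideal property of symmetric norms. -/
theorem IsSNFunction.symmNorm_mul_mul_le (hΦ : IsSNFunction Φ)
    (a : Matrix (Fin n) (Fin m) ℂ) (x : Matrix (Fin m) (Fin m) ℂ) (b : Matrix (Fin m) (Fin n) ℂ) :
    symmNorm Φ (a * x * b) ≤ ‖a‖ * symmNorm Φ x * ‖b‖ := by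
  by_cases ha : a = 0
  · simp [ha, hΦ.symmNorm_zero]
  by_cases hb : b = 0
  · simp [hb, hΦ.symmNorm_zero]
  have ha' : (‖a‖ : ℂ) ≠ 0 := by simpa using ha
  have hb' : (‖b‖ : ℂ) ≠ 0 := by simpa using hb
  have h := hΦ.symmNorm_mul_mul_le_of_norm_le_one ((‖a‖ : ℂ)⁻¹ • a) x ((‖b‖ : ℂ)⁻¹ • b)
    (by rw [norm_smul]; simp [ha]) (by rw [norm_smul]; simp [hb])
  have h2 : a * x * b = ((‖a‖ : ℂ) * ‖b‖) • ((‖a‖ : ℂ)⁻¹ • a * x * ((‖b‖ : ℂ)⁻¹ • b)) := by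
    simp only [Matrix.smul_mul, Matrix.mul_smul, smul_smul]
    rw [show (‖a‖ : ℂ) * ‖b‖ * ((‖b‖ : ℂ)⁻¹ * (‖a‖ : ℂ)⁻¹) = 1 by field_simp, one_smul]
  rw [h2, hΦ.symmNorm_smul, norm_mul, Complex.norm_real, Complex.norm_real, norm_norm, norm_norm]
  calc ‖a‖ * ‖b‖ * _ ≤ ‖a‖ * ‖b‖ * symmNorm Φ x := by gcongr
    _ = _ := by ring

theorem IsSNFunction.symmNorm_conjTranspose_le (hΦ : IsSNFunction Φ)
    (x : Matrix (Fin n) (Fin n) ℂ) : symmNorm Φ x.conjTranspose ≤ symmNorm Φ x := by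
  obtain ⟨P, Q, hP, hQ, h⟩ := exists_sv_eq_diag x.conjTranspose
  have h1 := hΦ.snFun_diag_le (star Q) x (star P) (norm_le_one_of_mem_unitary (Unitary.star_mem hQ))
    (norm_le_one_of_mem_unitary (Unitary.star_mem hP))
  have h2 : star Q * x * star P =
      Matrix.diagonal (fun i => (sv x.conjTranspose i : ℂ)) := by
    have := congrArg Matrix.conjTranspose h
    rw [Matrix.conjTranspose_mul, Matrix.conjTranspose_mul, Matrix.conjTranspose_conjTranspose,
      Matrix.diagonal_conjTranspose] at this
    rw [Matrix.star_eq_conjTranspose, Matrix.star_eq_conjTranspose, mul_assoc, this]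
    congr 1
    ext i
    simp
  rw [hΦ.symmNorm_eq]
  refine le_trans (le_of_eq (hΦ.snFun_congr_abs fun k => ?_)) h1
  simp [h2]

theorem IsSNFunction.symmNorm_conjTranspose (hΦ : IsSNFunction Φ)
    (x : Matrix (Fin n) (Fin n) ℂ) : symmNorm Φ x.conjTranspose = symmNorm Φ x := by
  refine le_antisymm (hΦ.symmNorm_conjTranspose_le x) ?_
  conv_lhs => rw [← x.conjTranspose_conjTranspose]
  exact hΦ.symmNorm_conjTranspose_le _

/-- The norm of a product of a contraction, a diagonal matrix and a contraction. -/
theorem IsSNFunction.symmNorm_mul_diagonal_mul_le (hΦ : IsSNFunction Φ)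
    (a b : Matrix (Fin n) (Fin n) ℂ) (d : Fin n → ℝ) (ha : ‖a‖ ≤ 1) (hb : ‖b‖ ≤ 1) :
    symmNorm Φ (a * Matrix.diagonal (fun i => (d i : ℂ)) * b) ≤ snFun Φ d := by
  obtain ⟨P, Q, hP, hQ, h⟩ := exists_sv_eq_diag (a * Matrix.diagonal (fun i => (d i : ℂ)) * b)
  have h1 := hΦ.snFun_mul_mul_diagonal_le (P * a) d (b * Q)
    ((Matrix.l2_opNorm_mul _ _).trans
      (mul_le_one₀ (norm_le_one_of_mem_unitary hP) (norm_nonneg _) ha))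
    ((Matrix.l2_opNorm_mul _ _).trans
      (mul_le_one₀ hb (norm_nonneg _) (norm_le_one_of_mem_unitary hQ)))
  rw [show P * a * Matrix.diagonal (fun i => (d i : ℂ)) * (b * Q) =
    P * (a * Matrix.diagonal (fun i => (d i : ℂ)) * b) * Q by simp only [mul_assoc], h] at h1
  rw [hΦ.symmNorm_eq]
  refine le_trans (le_of_eq (hΦ.snFun_congr_abs fun k => ?_)) h1
  simp

end Matrices

/-! ### The bilinear version of the map `ρ_T` -/

section RhoMap

variable {H : Type*} [NormedAddCommGroup H] [InnerProductSpace ℂ H] {n m : ℕ}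

/-- The map `x ↦ ∑ᵢ Tᵢ x Sᵢ*` for `T = ∑ᵢ ξᵢ ⊗ Tᵢ` and `S = ∑ᵢ ξᵢ ⊗ Sᵢ`. -/
noncomputable def rhoMap₂ (T S : Matrix (Fin n) (Fin n) H) (x : Matrix (Fin n) (Fin n) ℂ) :
    Matrix (Fin n) (Fin n) ℂ :=
  Matrix.of fun p q => ∑ r, ∑ s, inner ℂ (S q s) (T p r) * x r s

theorem rhoMap_eq_rhoMap₂ (T : Matrix (Fin n) (Fin n) H) (x : Matrix (Fin n) (Fin n) ℂ) :
    rhoMap T x = rhoMap₂ T T x := rfl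

theorem rhoMap_add (T S : Matrix (Fin n) (Fin n) H) (x : Matrix (Fin n) (Fin n) ℂ) :
    rhoMap (T + S) x = rhoMap T x + rhoMap₂ T S x + (rhoMap₂ S T x + rhoMap S x) := by
  ext p q
  simp only [rhoMap, rhoMap₂, Matrix.of_apply, Matrix.add_apply, inner_add_left, inner_add_right,
    add_mul, Finset.sum_add_distrib]

theorem rhoMap_smul_left (c : ℂ) (T : Matrix (Fin n) (Fin n) H) (x : Matrix (Fin n) (Fin n) ℂ) :
    rhoMap (c • T) x = ((‖c‖ ^ 2 : ℝ) : ℂ) • rhoMap T x := by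
  ext p q
  simp only [rhoMap, Matrix.of_apply, Matrix.smul_apply, inner_smul_left, inner_smul_right,
    smul_eq_mul, Finset.mul_sum]
  refine Finset.sum_congr rfl fun r _ => Finset.sum_congr rfl fun s _ => ?_
  rw [Complex.ofReal_pow, ← Complex.mul_conj', mul_assoc, mul_assoc, mul_assoc, mul_left_comm]

theorem rhoMap_smul (c : ℂ) (T : Matrix (Fin n) (Fin n) H) (x : Matrix (Fin n) (Fin n) ℂ) :
    rhoMap T (c • x) = c • rhoMap T x := by
  ext p q
  simp only [rhoMap, Matrix.of_apply, Matrix.smul_apply, smul_eq_mul, Finset.mul_sum]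
  exact Finset.sum_congr rfl fun r _ => Finset.sum_congr rfl fun s _ => by ring

/-- In coefficients this is `∑ (a Tᵢ b) x (c Sᵢ d)* = a (∑ Tᵢ (b x d*) Sᵢ*) c*`. The two sides are
the same six-fold sum of `F` in different orders of summation. -/
theorem rhoMap₂_scalarSandwich (a c : Matrix (Fin n) (Fin m) ℂ) (b d : Matrix (Fin m) (Fin n) ℂ)
    (T S : Matrix (Fin m) (Fin m) H) (x : Matrix (Fin n) (Fin n) ℂ) :
    rhoMap₂ (scalarSandwich a T b) (scalarSandwich c S d) x
      = a * rhoMap₂ T S (b * x * d.conjTranspose) * c.conjTranspose := by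
  ext p q
  let F : Fin n → Fin n → Fin m → Fin m → Fin m → Fin m → ℂ := fun r s k l k' l' =>
    a p k * (inner ℂ (S k' l') (T k l) * (b l r * x r s * star (d l' s))) * star (c q k')
  have h1 : rhoMap₂ (scalarSandwich a T b) (scalarSandwich c S d) x p q =
      ∑ r, ∑ s, ∑ k, ∑ l, ∑ k', ∑ l', F r s k l k' l' := by
    simp only [rhoMap₂, scalarSandwich, Matrix.of_apply, inner_sum, sum_inner, inner_smul_left,
      inner_smul_right, Finset.sum_mul, Finset.mul_sum, F]
    refine Finset.sum_congr rfl fun r _ => Finset.sum_congr rfl fun s _ =>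
      Finset.sum_congr rfl fun k _ => Finset.sum_congr rfl fun l _ =>
      Finset.sum_congr rfl fun k' _ => Finset.sum_congr rfl fun l' _ => ?_
    simp only [map_mul, starRingEnd_apply]
    ring
  have h2 : (a * rhoMap₂ T S (b * x * d.conjTranspose) * c.conjTranspose) p q =
      ∑ k', ∑ k, ∑ l, ∑ l', ∑ s, ∑ r, F r s k l k' l' := by
    simp only [rhoMap₂, Matrix.mul_apply, Matrix.of_apply, Matrix.conjTranspose_apply,
      Finset.mul_sum, Finset.sum_mul, F]
  rw [h1, h2]
  simp only [← Fintype.sum_prod_type']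
  exact Fintype.sum_equiv ⟨fun z => ⟨z.2.2.2.2.1, z.2.2.1, z.2.2.2.1, z.2.2.2.2.2, z.2.1, z.1⟩,
    fun z => ⟨z.2.2.2.2.2, z.2.2.2.2.1, z.2.1, z.2.2.1, z.1, z.2.2.2.1⟩,
    fun _ => rfl, fun _ => rfl⟩ _ _ fun _ => rfl

theorem rhoMap_scalarSandwich (a : Matrix (Fin n) (Fin m) ℂ) (b : Matrix (Fin m) (Fin n) ℂ)
    (T : Matrix (Fin m) (Fin m) H) (x : Matrix (Fin n) (Fin n) ℂ) :
    rhoMap (scalarSandwich a T b) x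
      = a * rhoMap T (b * x * b.conjTranspose) * a.conjTranspose :=
  rhoMap₂_scalarSandwich a a b b T T x

theorem rhoMap₂_diagonal_apply (T S : Matrix (Fin n) (Fin n) H) (d : Fin n → ℂ) (p q : Fin n) :
    rhoMap₂ T S (Matrix.diagonal d) p q = ∑ r, inner ℂ (S q r) (T p r) * d r := by
  simp [rhoMap₂, Matrix.diagonal_apply]

variable {Φ Ψ : (ℕ →₀ ℝ) → ℝ}

/-- The Cauchy–Schwarz inequality for `ρ`. -/
theorem symmNorm_rhoMap₂_le (hΦ : IsSNFunction Φ) (hΨ : IsSNFunction Ψ)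
    (T S : Matrix (Fin n) (Fin n) H) {A B : ℝ} (hA : 0 < A) (hB : 0 < B)
    (hT : ∀ x, symmNorm Ψ (rhoMap T x) ≤ A ^ 2 * symmNorm Φ x)
    (hS : ∀ x, symmNorm Ψ (rhoMap S x) ≤ B ^ 2 * symmNorm Φ x)
    (x : Matrix (Fin n) (Fin n) ℂ) :
    symmNorm Ψ (rhoMap₂ T S x) ≤ A * B * symmNorm Φ x := by
  obtain ⟨U, hU, V, hV, hx⟩ := exists_svd x
  obtain ⟨P, Q, hP, hQ, hy⟩ := exists_sv_eq_diag (rhoMap₂ T S x)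
  have nU := norm_le_one_of_mem_unitary hU
  have nV := norm_le_one_of_mem_unitary hV
  have nP := norm_le_one_of_mem_unitary hP
  have nQ := norm_le_one_of_mem_unitary hQ
  let D : Matrix (Fin n) (Fin n) ℂ := Matrix.diagonal fun i => (sv x i : ℂ)
  -- The singular factors of `x` and the unitaries diagonalizing `rhoMap₂ T S x` are absorbed into
  -- `T` and `S`. Then the singular values of `rhoMap₂ T S x` are the diagonal entries of `rhoMap₂
  -- T' S' D`, and `α`, `β` are the diagonals of `rhoMap T' D` and `rhoMap S' D`.
  let T' := scalarSandwich P T U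
  let S' := scalarSandwich Q.conjTranspose S V.conjTranspose
  have hTS : rhoMap₂ T' S' D = Matrix.diagonal (fun i => (sv (rhoMap₂ T S x) i : ℂ)) := by
    rw [rhoMap₂_scalarSandwich, Matrix.conjTranspose_conjTranspose,
      Matrix.conjTranspose_conjTranspose, ← hx, hy]
  let α : Fin n → ℝ := fun k => ∑ r, ‖T' k r‖ ^ 2 * sv x r
  let β : Fin n → ℝ := fun k => ∑ r, ‖S' k r‖ ^ 2 * sv x r
  have hα0 : ∀ k, 0 ≤ α k := fun k => Finset.sum_nonneg fun r _ =>
    mul_nonneg (by positivity) (sv_nonneg x r)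
  have hβ0 : ∀ k, 0 ≤ β k := fun k => Finset.sum_nonneg fun r _ =>
    mul_nonneg (by positivity) (sv_nonneg x r)
  have hαD : ∀ k, rhoMap T' D k k = (α k : ℂ) := fun k => by
    rw [rhoMap_eq_rhoMap₂, rhoMap₂_diagonal_apply]
    simp [α, inner_self_eq_norm_sq_to_K]
  have hβD : ∀ k, rhoMap S' D k k = (β k : ℂ) := fun k => by
    rw [rhoMap_eq_rhoMap₂, rhoMap₂_diagonal_apply]
    simp [β, inner_self_eq_norm_sq_to_K]
  have hD : symmNorm Φ (U * D * U.conjTranspose) ≤ symmNorm Φ x := by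
    rw [hΦ.symmNorm_eq x]
    exact hΦ.symmNorm_mul_diagonal_mul_le _ _ _ nU (by rwa [Matrix.l2_opNorm_conjTranspose])
  have hD' : symmNorm Φ (V.conjTranspose * D * V) ≤ symmNorm Φ x := by
    rw [hΦ.symmNorm_eq x]
    exact hΦ.symmNorm_mul_diagonal_mul_le _ _ _ (by rwa [Matrix.l2_opNorm_conjTranspose]) nV
  have hα : snFun Ψ α ≤ A ^ 2 * symmNorm Φ x := by
    calc snFun Ψ α ≤ symmNorm Ψ (rhoMap T (U * D * U.conjTranspose)) := by
          refine le_trans (le_of_eq (hΨ.snFun_congr_abs fun k => ?_)) (hΨ.snFun_diag_le P _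
            P.conjTranspose nP (by rwa [Matrix.l2_opNorm_conjTranspose]))
          rw [← rhoMap_scalarSandwich, hαD, Complex.norm_real, Real.norm_eq_abs, abs_abs]
      _ ≤ A ^ 2 * symmNorm Φ (U * D * U.conjTranspose) := hT _
      _ ≤ A ^ 2 * symmNorm Φ x := by gcongr
  have hβ : snFun Ψ β ≤ B ^ 2 * symmNorm Φ x := by
    calc snFun Ψ β ≤ symmNorm Ψ (rhoMap S (V.conjTranspose * D * V)) := by
          refine le_trans (le_of_eq (hΨ.snFun_congr_abs fun k => ?_)) (hΨ.snFun_diag_le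
            Q.conjTranspose _ Q (by rwa [Matrix.l2_opNorm_conjTranspose]) nQ)
          have h := rhoMap_scalarSandwich Q.conjTranspose V.conjTranspose S D
          rw [Matrix.conjTranspose_conjTranspose, Matrix.conjTranspose_conjTranspose] at h
          rw [← h, hβD, Complex.norm_real, Real.norm_eq_abs, abs_abs]
      _ ≤ B ^ 2 * symmNorm Φ (V.conjTranspose * D * V) := hS _
      _ ≤ B ^ 2 * symmNorm Φ x := by gcongr
  -- Cauchy–Schwarz in `H`, then weighted AM–GM; these weights turn the bounds `A ^ 2` and `B ^ 2`
  -- into two equal halves of `A * B`.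
  have hk : ∀ k, sv (rhoMap₂ T S x) k ≤ ((B / (2 * A)) • α + (A / (2 * B)) • β) k := by
    intro k
    have h1 : (sv (rhoMap₂ T S x) k : ℂ) = ∑ r, inner ℂ (S' k r) (T' k r) * (sv x r : ℂ) := by
      rw [← rhoMap₂_diagonal_apply, hTS, Matrix.diagonal_apply_eq]
    rw [← abs_of_nonneg (sv_nonneg (rhoMap₂ T S x) k), ← Real.norm_eq_abs, ← Complex.norm_real, h1,
      Pi.add_apply, Pi.smul_apply, Pi.smul_apply, smul_eq_mul, smul_eq_mul, Finset.mul_sum,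
      Finset.mul_sum, ← Finset.sum_add_distrib]
    refine (norm_sum_le _ _).trans (Finset.sum_le_sum fun r _ => ?_)
    rw [norm_mul, Complex.norm_real, Real.norm_eq_abs, abs_of_nonneg (sv_nonneg x r),
      ← mul_assoc, ← mul_assoc, ← add_mul]
    refine mul_le_mul_of_nonneg_right ((norm_inner_le_norm _ _).trans ?_) (sv_nonneg x r)
    have h2 : B / (2 * A) * ‖T' k r‖ ^ 2 + A / (2 * B) * ‖S' k r‖ ^ 2 - ‖S' k r‖ * ‖T' k r‖ =
        (B * ‖T' k r‖ - A * ‖S' k r‖) ^ 2 / (2 * A * B) := by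
      field_simp
      ring
    have h3 : 0 ≤ (B * ‖T' k r‖ - A * ‖S' k r‖) ^ 2 / (2 * A * B) := by positivity
    linarith
  calc symmNorm Ψ (rhoMap₂ T S x) = snFun Ψ (sv (rhoMap₂ T S x)) := hΨ.symmNorm_eq _
    _ ≤ snFun Ψ ((B / (2 * A)) • α + (A / (2 * B)) • β) := hΨ.snFun_mono fun k => by
        rw [abs_of_nonneg (sv_nonneg _ k)]
        exact (hk k).trans (le_abs_self _)
    _ ≤ B / (2 * A) * snFun Ψ α + A / (2 * B) * snFun Ψ β := by
        refine (hΨ.snFun_add_le _ _).trans (le_of_eq ?_)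
        rw [hΨ.snFun_smul, hΨ.snFun_smul, abs_of_pos (by positivity), abs_of_pos (by positivity)]
    _ ≤ B / (2 * A) * (A ^ 2 * symmNorm Φ x) + A / (2 * B) * (B ^ 2 * symmNorm Φ x) := by gcongr
    _ = A * B * symmNorm Φ x := by field_simp; ring

/-- A crude bound by the ideal property, applied to each term of an orthonormal expansion. It makes
the set defining `hilbertNorm` bounded above, so that its `sSup` is a genuine supremum. -/
theorem exists_symmNorm_rhoMap_le (hΨ : IsSNFunction Ψ)
    (hle : ∀ a, Ψ a ≤ Φ a) (T : Matrix (Fin n) (Fin n) H) :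
    ∃ C, ∀ x, symmNorm Ψ (rhoMap T x) ≤ C * symmNorm Φ x := by
  obtain ⟨k, ξ, t, hξ, rfl⟩ := exists_orthonormal_expansion T
  refine ⟨∑ i, ‖t i‖ * ‖(t i).conjTranspose‖, fun x => ?_⟩
  rw [rhoMap_eq_sum hξ, Finset.sum_mul]
  refine (hΨ.symmNorm_sum_le _ _).trans (Finset.sum_le_sum fun i _ => ?_)
  refine (hΨ.symmNorm_mul_mul_le _ _ _).trans ?_
  have := hle (Matrix.toEuclideanLin x).singularValues
  calc ‖t i‖ * symmNorm Ψ x * ‖(t i).conjTranspose‖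
      ≤ ‖t i‖ * symmNorm Φ x * ‖(t i).conjTranspose‖ := by
        gcongr
        exact this
    _ = _ := by ring

/-! ### The norms of `H(Φ, Ψ)` -/

theorem hilbertNorm_nonneg (T : Matrix (Fin n) (Fin n) H) : 0 ≤ hilbertNorm H Φ Ψ n T :=
  Real.sqrt_nonneg _

theorem symmNorm_rhoMap_le_hilbertNorm (hΦ : IsSNFunction Φ) (hΨ : IsSNFunction Ψ)
    (hle : ∀ a, Ψ a ≤ Φ a) (T : Matrix (Fin n) (Fin n) H) (x : Matrix (Fin n) (Fin n) ℂ) :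
    symmNorm Ψ (rhoMap T x) ≤ hilbertNorm H Φ Ψ n T ^ 2 * symmNorm Φ x := by
  obtain ⟨C, hC⟩ := exists_symmNorm_rhoMap_le hΨ hle T
  have hbdd : BddAbove {r : ℝ | ∃ x : Matrix (Fin n) (Fin n) ℂ, symmNorm Φ x ≤ 1 ∧
      r = symmNorm Ψ (rhoMap T x)} := by
    refine ⟨|C|, ?_⟩
    rintro _ ⟨y, hy, rfl⟩
    calc symmNorm Ψ (rhoMap T y) ≤ C * symmNorm Φ y := hC y
      _ ≤ |C| * 1 := mul_le_mul (le_abs_self C) hy (hΦ.symmNorm_nonneg y) (abs_nonneg C)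
      _ = |C| := mul_one _
  have hle1 : ∀ y : Matrix (Fin n) (Fin n) ℂ, symmNorm Φ y ≤ 1 →
      symmNorm Ψ (rhoMap T y) ≤ hilbertNorm H Φ Ψ n T ^ 2 := fun y hy => by
    have h := le_csSup hbdd ⟨y, hy, rfl⟩
    rw [hilbertNorm, Real.sq_sqrt ((hΨ.symmNorm_nonneg _).trans h)]
    exact h
  -- A matrix of norm zero cannot be rescaled to the unit ball; there the crude bound `C` already
  -- gives zero.
  rcases (hΦ.symmNorm_nonneg x).eq_or_lt with h0 | h0
  · have := hC x
    rw [← h0, mul_zero] at this ⊢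
    exact this
  · have h := hle1 (((symmNorm Φ x)⁻¹ : ℝ) • x) (by
      rw [← Complex.coe_smul, hΦ.symmNorm_smul, Complex.norm_real, Real.norm_eq_abs,
        abs_of_pos (inv_pos.2 h0), inv_mul_cancel₀ h0.ne'])
    rw [← Complex.coe_smul, rhoMap_smul, hΨ.symmNorm_smul, Complex.norm_real, Real.norm_eq_abs,
      abs_of_pos (inv_pos.2 h0), inv_mul_le_iff₀ h0] at h
    linarith

theorem hilbertNorm_le (hΦ : IsSNFunction Φ) {T : Matrix (Fin n) (Fin n) H} {c : ℝ} (hc : 0 ≤ c)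
    (h : ∀ x, symmNorm Ψ (rhoMap T x) ≤ c ^ 2 * symmNorm Φ x) : hilbertNorm H Φ Ψ n T ≤ c := by
  refine Real.sqrt_le_iff.2 ⟨hc, csSup_le ⟨_, 0, by simp [hΦ.symmNorm_zero], rfl⟩ ?_⟩
  rintro _ ⟨x, hx, rfl⟩
  exact (h x).trans (mul_le_of_le_one_right (by positivity) hx)

theorem symmNorm_rhoMap₂_le_hilbertNorm (hΦ : IsSNFunction Φ) (hΨ : IsSNFunction Ψ)
    (hle : ∀ a, Ψ a ≤ Φ a) (T S : Matrix (Fin n) (Fin n) H) (x : Matrix (Fin n) (Fin n) ℂ) :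
    symmNorm Ψ (rhoMap₂ T S x) ≤
      hilbertNorm H Φ Ψ n T * hilbertNorm H Φ Ψ n S * symmNorm Φ x := by
  have hT := symmNorm_rhoMap_le_hilbertNorm hΦ hΨ hle T
  have hS := symmNorm_rhoMap_le_hilbertNorm hΦ hΨ hle S
  have hA := hilbertNorm_nonneg (Φ := Φ) (Ψ := Ψ) T
  have hB := hilbertNorm_nonneg (Φ := Φ) (Ψ := Ψ) S
  generalize hilbertNorm H Φ Ψ n T = A at *
  generalize hilbertNorm H Φ Ψ n S = B at *
  have mono : ∀ {c ε : ℝ} (y : Matrix (Fin n) (Fin n) ℂ), 0 ≤ c → 0 < ε →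
      c ^ 2 * symmNorm Φ y ≤ (c + ε) ^ 2 * symmNorm Φ y := fun y hc hε =>
    mul_le_mul_of_nonneg_right (pow_le_pow_left₀ hc (by linarith) 2) (hΦ.symmNorm_nonneg y)
  -- The Cauchy–Schwarz estimate divides by its two constants, so they are made positive by `ε`,
  -- which then tends to zero.
  have h : ∀ ε > 0, symmNorm Ψ (rhoMap₂ T S x) ≤ (A + ε) * (B + ε) * symmNorm Φ x :=
    fun ε hε => symmNorm_rhoMap₂_le (A := A + ε) (B := B + ε) hΦ hΨ T S (by positivity)
      (by positivity) (fun y => (hT y).trans (mono y hA hε)) (fun y => (hS y).trans (mono y hB hε)) x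
  have hcont : Continuous fun ε : ℝ => (A + ε) * (B + ε) * symmNorm Φ x := by fun_prop
  have hlim : Filter.Tendsto (fun ε : ℝ => (A + ε) * (B + ε) * symmNorm Φ x)
      (nhdsWithin 0 (Set.Ioi 0)) (nhds (A * B * symmNorm Φ x)) := by
    simpa using (hcont.tendsto 0).mono_left nhdsWithin_le_nhds
  exact ge_of_tendsto hlim (by filter_upwards [self_mem_nhdsWithin] with ε hε using h ε hε)

theorem hilbertNorm_add_le (hΦ : IsSNFunction Φ) (hΨ : IsSNFunction Ψ)
    (hle : ∀ a, Ψ a ≤ Φ a) (T S : Matrix (Fin n) (Fin n) H) :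
    hilbertNorm H Φ Ψ n (T + S) ≤ hilbertNorm H Φ Ψ n T + hilbertNorm H Φ Ψ n S := by
  refine hilbertNorm_le hΦ (add_nonneg (hilbertNorm_nonneg T) (hilbertNorm_nonneg S)) fun x => ?_
  rw [rhoMap_add]
  have h1 := symmNorm_rhoMap_le_hilbertNorm hΦ hΨ hle T x
  have h2 := symmNorm_rhoMap_le_hilbertNorm hΦ hΨ hle S x
  have h3 := symmNorm_rhoMap₂_le_hilbertNorm hΦ hΨ hle T S x
  have h4 := symmNorm_rhoMap₂_le_hilbertNorm hΦ hΨ hle S T x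
  calc _ ≤ symmNorm Ψ (rhoMap T x) + symmNorm Ψ (rhoMap₂ T S x) +
        (symmNorm Ψ (rhoMap₂ S T x) + symmNorm Ψ (rhoMap S x)) :=
        (hΨ.symmNorm_add_le _ _).trans
          (add_le_add (hΨ.symmNorm_add_le _ _) (hΨ.symmNorm_add_le _ _))
    _ ≤ _ := by linarith

theorem hilbertNorm_eq_zero (hΦ : IsSNFunction Φ) (hΨ : IsSNFunction Ψ)
    (hle : ∀ a, Ψ a ≤ Φ a) {T : Matrix (Fin n) (Fin n) H} (h : hilbertNorm H Φ Ψ n T = 0) :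
    T = 0 := by
  -- The identity detects `T`: the diagonal entry `p` of `rhoMap T 1` is `∑ r, ‖T p r‖ ^ 2`.
  have h1 := symmNorm_rhoMap_le_hilbertNorm hΦ hΨ hle T 1
  rw [h, zero_pow two_ne_zero, zero_mul] at h1
  have h2 := hΨ.symmNorm_eq_zero (le_antisymm h1 (hΨ.symmNorm_nonneg _))
  ext p q
  have h3 := congrFun (congrFun h2 p) p
  rw [← Matrix.diagonal_one, rhoMap_eq_rhoMap₂, rhoMap₂_diagonal_apply] at h3
  have h4 : ∑ r, ‖T p r‖ ^ 2 = 0 := by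
    have h5 : ((∑ r, ‖T p r‖ ^ 2 : ℝ) : ℂ) = 0 := by
      simpa [inner_self_eq_norm_sq_to_K] using h3
    exact_mod_cast h5
  rw [Finset.sum_eq_zero_iff_of_nonneg (fun _ _ => by positivity)] at h4
  simpa using h4 q (Finset.mem_univ _)

theorem hilbertNorm_smul_le (hΦ : IsSNFunction Φ) (hΨ : IsSNFunction Ψ)
    (hle : ∀ a, Ψ a ≤ Φ a) (c : ℂ) (T : Matrix (Fin n) (Fin n) H) :
    hilbertNorm H Φ Ψ n (c • T) ≤ ‖c‖ * hilbertNorm H Φ Ψ n T := by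
  refine hilbertNorm_le hΦ (mul_nonneg (norm_nonneg _) (hilbertNorm_nonneg T)) fun x => ?_
  rw [rhoMap_smul_left, hΨ.symmNorm_smul, Complex.norm_real, Real.norm_eq_abs,
    abs_of_nonneg (by positivity), mul_pow, mul_assoc]
  gcongr
  exact symmNorm_rhoMap_le_hilbertNorm hΦ hΨ hle T x

theorem hilbertNorm_smul (hΦ : IsSNFunction Φ) (hΨ : IsSNFunction Ψ)
    (hle : ∀ a, Ψ a ≤ Φ a) (c : ℂ) (T : Matrix (Fin n) (Fin n) H) :
    hilbertNorm H Φ Ψ n (c • T) = ‖c‖ * hilbertNorm H Φ Ψ n T := by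
  refine le_antisymm (hilbertNorm_smul_le hΦ hΨ hle c T) ?_
  by_cases hc : c = 0
  · subst hc; simpa using hilbertNorm_nonneg _
  · have h := hilbertNorm_smul_le hΦ hΨ hle c⁻¹ (c • T)
    rw [inv_smul_smul₀ hc, norm_inv] at h
    rwa [le_inv_mul_iff₀ (norm_pos_iff.2 hc)] at h

theorem hilbertNorm_scalarSandwich_le (hΦ : IsSNFunction Φ) (hΨ : IsSNFunction Ψ)
    (hle : ∀ a, Ψ a ≤ Φ a) (a : Matrix (Fin n) (Fin m) ℂ) (T : Matrix (Fin m) (Fin m) H)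
    (b : Matrix (Fin m) (Fin n) ℂ) :
    hilbertNorm H Φ Ψ n (scalarSandwich a T b) ≤ ‖a‖ * hilbertNorm H Φ Ψ m T * ‖b‖ := by
  refine hilbertNorm_le hΦ (mul_nonneg (mul_nonneg (norm_nonneg _) (hilbertNorm_nonneg T))
    (norm_nonneg _)) fun x => ?_
  rw [rhoMap_scalarSandwich]
  have h1 := hΦ.symmNorm_mul_mul_le b x b.conjTranspose
  rw [Matrix.l2_opNorm_conjTranspose] at h1
  calc _ ≤ ‖a‖ * symmNorm Ψ (rhoMap T (b * x * b.conjTranspose)) * ‖a.conjTranspose‖ :=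
        hΨ.symmNorm_mul_mul_le _ _ _
    _ ≤ ‖a‖ * (hilbertNorm H Φ Ψ m T ^ 2 * (‖b‖ * symmNorm Φ x * ‖b‖)) * ‖a‖ := by
        rw [Matrix.l2_opNorm_conjTranspose]
        gcongr
        exact (symmNorm_rhoMap_le_hilbertNorm hΦ hΨ hle T _).trans (by gcongr)
    _ = _ := by ring

theorem IsSNFunction.symmNorm_fin_one (hΦ : IsSNFunction Φ) (x : Matrix (Fin 1) (Fin 1) ℂ) :
    symmNorm Φ x = ‖x 0 0‖ := by
  have h1 : ∀ d : Fin 1 → ℝ, snFun Φ d = |d 0| := fun d => by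
    rw [← hΦ.snFun_single (0 : Fin 1)]
    congr 1
    ext i
    rw [Subsingleton.elim i 0, Pi.single_eq_same]
  refine le_antisymm ?_ ?_
  · have h := hΦ.symmNorm_smul_le (x 0 0) (1 : Matrix (Fin 1) (Fin 1) ℂ)
    have h2 := hΦ.symmNorm_mul_diagonal_mul_le (n := 1) 1 1 1 norm_one.le norm_one.le
    rw [h1] at h2
    simp only [Pi.one_apply, Complex.ofReal_one, abs_one, Matrix.diagonal_one, mul_one] at h2
    have h3 : x = x 0 0 • (1 : Matrix (Fin 1) (Fin 1) ℂ) := by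
      ext i j
      simp [Subsingleton.elim i 0, Subsingleton.elim j 0]
    rw [← h3] at h
    exact h.trans (mul_le_of_le_one_right (norm_nonneg _) h2)
  · have h := hΦ.snFun_diag_le (n := 1) 1 x 1 norm_one.le norm_one.le
    rw [h1] at h
    simpa using h

theorem hilbertNorm_fin_one (hΦ : IsSNFunction Φ) (hΨ : IsSNFunction Ψ)
    (hle : ∀ a, Ψ a ≤ Φ a) (e : H) :
    hilbertNorm H Φ Ψ 1 (Matrix.of fun _ _ => e) = ‖e‖ := by
  have h : ∀ x : Matrix (Fin 1) (Fin 1) ℂ,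
      symmNorm Ψ (rhoMap (Matrix.of fun _ _ => e) x) = ‖e‖ ^ 2 * symmNorm Φ x := fun x => by
    rw [hΨ.symmNorm_fin_one, hΦ.symmNorm_fin_one]
    simp [rhoMap, inner_self_eq_norm_sq_to_K]
  refine le_antisymm (hilbertNorm_le hΦ (norm_nonneg e) fun x => (h x).le) ?_
  have h2 := symmNorm_rhoMap_le_hilbertNorm hΦ hΨ hle (Matrix.of fun _ _ => e)
    (1 : Matrix (Fin 1) (Fin 1) ℂ)
  rw [h, hΦ.symmNorm_fin_one] at h2
  simp only [Matrix.one_apply_eq, norm_one, mul_one] at h2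
  exact le_of_sq_le_sq h2 (hilbertNorm_nonneg _)

end RhoMap

/-! ### Q-norms -/

section QNorms

variable {ι : Type*} [Fintype ι] {n m : ℕ} {Φ Ψ Θ Υ : (ℕ →₀ ℝ) → ℝ}

theorem snFun_twoConvexification (hΥ : IsSNFunction Υ) (v : ι → ℝ) :
    snFun (twoConvexification Υ) v ^ 2 = snFun Υ (v ^ 2) := by
  rw [snFun, twoConvexification, Real.sq_sqrt (hΥ.nonneg _), snFun]
  congr 1
  refine eq_toSeq _ (fun i => ?_) fun k hk => ?_
  · simp [toSeq_apply]
  · simp [toSeq_of_notMem _ _ hk]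

/-- Every s.n. function is at most the `ℓ¹` norm; applied to `Υ`, this puts its 2-convexification
below `ℓ²`. -/
theorem IsQNorm.snFun_sq_le_sum (hΨ : IsQNorm Ψ) (v : ι → ℝ) :
    snFun Ψ v ^ 2 ≤ ∑ i, v i ^ 2 := by
  obtain ⟨-, Υ, hΥ, rfl⟩ := hΨ
  rw [snFun_twoConvexification hΥ]
  refine (hΥ.snFun_le_sum (v ^ 2)).trans (le_of_eq (Finset.sum_congr rfl fun i _ => ?_))
  rw [Pi.pow_apply, abs_of_nonneg (sq_nonneg _)]

/-- The matrix `z* z` is unitarily diagonalized with eigenvalues `sv z ^ 2`, so the estimate for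
contraction times diagonal times contraction applies. -/
theorem IsSNFunction.snFun_diag_conjTranspose_mul_self_le (hΥ : IsSNFunction Υ)
    (z b c : Matrix (Fin n) (Fin n) ℂ) (hb : ‖b‖ ≤ 1) (hc : ‖c‖ ≤ 1) :
    snFun Υ (fun k => ‖(b * (z.conjTranspose * z) * c) k k‖) ≤ snFun Υ (sv z ^ 2) := by
  obtain ⟨U, hU, V, hV, hz⟩ := exists_svd z
  have h : z.conjTranspose * z =
      V.conjTranspose * Matrix.diagonal (fun i => (((sv z ^ 2) i : ℝ) : ℂ)) * V := by
    have hU' : U.conjTranspose * U = 1 := Matrix.mem_unitaryGroup_iff'.1 hU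
    have hd : (Matrix.diagonal (fun i => (sv z i : ℂ))).conjTranspose *
        Matrix.diagonal (fun i => (sv z i : ℂ)) =
        Matrix.diagonal (fun i => (((sv z ^ 2) i : ℝ) : ℂ)) := by
      rw [Matrix.diagonal_conjTranspose, Matrix.diagonal_mul_diagonal]
      congr 1
      ext i
      simp [sq]
    conv_lhs => rw [hz]
    rw [← hd, Matrix.conjTranspose_mul, Matrix.conjTranspose_mul]
    simp only [mul_assoc]
    rw [← mul_assoc U.conjTranspose U, hU', one_mul]
  have hV' := norm_le_one_of_mem_unitary hV
  refine le_trans (le_of_eq ?_) (hΥ.snFun_mul_mul_diagonal_le (b * V.conjTranspose) (sv z ^ 2)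
    (V * c) ?_ ?_)
  · rw [h]
    simp only [mul_assoc]
  · exact (norm_mul_le _ _).trans
      (mul_le_one₀ hb (norm_nonneg _) (by rwa [Matrix.l2_opNorm_conjTranspose]))
  · exact (norm_mul_le _ _).trans (mul_le_one₀ hV' (norm_nonneg _) hc)

/-- Q-norms satisfy an upper Pythagorean estimate. -/
theorem IsQNorm.symmNorm_sq_le (hΨ : IsQNorm Ψ) {P Q : Matrix (Fin n) (Fin n) ℂ}
    (hPQ : P.conjTranspose * P + Q.conjTranspose * Q = 1) (y : Matrix (Fin n) (Fin n) ℂ) :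
    symmNorm Ψ y ^ 2 ≤ symmNorm Ψ (P * y) ^ 2 + symmNorm Ψ (Q * y) ^ 2 := by
  obtain ⟨hΨ, Υ, hΥ, rfl⟩ := hΨ
  simp only [hΨ.symmNorm_eq, snFun_twoConvexification hΥ]
  obtain ⟨U, W, hU, hW, hy⟩ := exists_sv_eq_diag y
  have nW := norm_le_one_of_mem_unitary hW
  have nW' : ‖W.conjTranspose‖ ≤ 1 := by rwa [Matrix.l2_opNorm_conjTranspose]
  have hU' : U.conjTranspose * U = 1 := Matrix.mem_unitaryGroup_iff'.1 hU
  -- Since `y* y = (P y)* (P y) + (Q y)* (Q y)`, the squared singular values of `y` are the sum of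
  -- two diagonals. The triangle inequality for `Υ` then separates them.
  have h1 : W.conjTranspose * ((P * y).conjTranspose * (P * y)) * W +
      W.conjTranspose * ((Q * y).conjTranspose * (Q * y)) * W =
      Matrix.diagonal (fun i => (((sv y ^ 2) i : ℝ) : ℂ)) := by
    calc _ = W.conjTranspose * (y.conjTranspose *
          (P.conjTranspose * P + Q.conjTranspose * Q) * y) * W := by
          simp only [Matrix.conjTranspose_mul, mul_add, add_mul, mul_assoc]
      _ = (U * y * W).conjTranspose * (U * y * W) := by
          rw [hPQ, mul_one, Matrix.conjTranspose_mul, Matrix.conjTranspose_mul]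
          simp only [mul_assoc]
          rw [← mul_assoc U.conjTranspose U, hU', one_mul]
      _ = _ := by
          rw [hy, Matrix.diagonal_conjTranspose, Matrix.diagonal_mul_diagonal]
          congr 1
          ext i
          simp [sq]
  refine le_trans (le_trans (hΥ.snFun_mono fun k => ?_) (hΥ.snFun_add_le _ _)) (add_le_add
    (hΥ.snFun_diag_conjTranspose_mul_self_le (P * y) W.conjTranspose W nW' nW)
    (hΥ.snFun_diag_conjTranspose_mul_self_le (Q * y) W.conjTranspose W nW' nW))
  refine le_trans ?_ (le_abs_self _)
  rw [← Real.norm_eq_abs, ← Complex.norm_real,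
    ← Matrix.diagonal_apply_eq (fun i => (((sv y ^ 2) i : ℝ) : ℂ)), ← h1, Matrix.add_apply]
  exact norm_add_le _ _

theorem IsQNorm.symmNorm_sq_le_right (hΨ : IsQNorm Ψ) {P Q : Matrix (Fin n) (Fin n) ℂ}
    (hPQ : P * P.conjTranspose + Q * Q.conjTranspose = 1) (y : Matrix (Fin n) (Fin n) ℂ) :
    symmNorm Ψ y ^ 2 ≤ symmNorm Ψ (y * P) ^ 2 + symmNorm Ψ (y * Q) ^ 2 := by
  have h := hΨ.symmNorm_sq_le (P := P.conjTranspose) (Q := Q.conjTranspose) (by simpa using hPQ)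
    y.conjTranspose
  rwa [← Matrix.conjTranspose_mul, ← Matrix.conjTranspose_mul, hΨ.1.symmNorm_conjTranspose,
    hΨ.1.symmNorm_conjTranspose, hΨ.1.symmNorm_conjTranspose] at h

/-! ### Duality -/

theorem exists_eq_toSeq_fin (ξ : ℕ →₀ ℝ) :
    ∃ N : ℕ, ∀ n, N ≤ n → ξ = toSeq Fin.valEmbedding (fun i : Fin n => ξ i) := by
  refine ⟨ξ.support.sup id + 1, fun n hn => eq_toSeq _ (fun i => rfl) fun k hk => ?_⟩
  by_contra h
  have h1 : k ≤ ξ.support.sup id := Finset.le_sup (f := id) (Finsupp.mem_support_iff.2 h)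
  exact hk ⟨⟨k, by omega⟩, rfl⟩

theorem IsSNFunction.snFun_restrict_le (hΦ : IsSNFunction Φ) (ξ : ℕ →₀ ℝ) (n : ℕ) :
    snFun Φ (fun i : Fin n => ξ i) ≤ Φ ξ := by
  obtain ⟨N, hN⟩ := exists_eq_toSeq_fin ξ
  have h := hN (N + n) (by omega)
  conv_rhs => rw [h, hΦ.toSeq_eq]
  have h1 := hΦ.snFun_comp_embedding (Fin.castLEEmb (by omega : n ≤ N + n))
    (fun i : Fin (N + n) => if (i : ℕ) < n then ξ i else 0) fun k hk => by
      rw [if_neg fun hkn => hk ⟨⟨k, hkn⟩, Fin.ext rfl⟩]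
  calc snFun Φ (fun i : Fin n => ξ i) = _ := by
        rw [← h1]
        congr 1
        ext i
        simp
    _ ≤ _ := hΦ.snFun_mono fun i => by
        split_ifs <;> simp

theorem toSeq_mem_decreasingCone {v : Fin n → ℝ} (hv : Antitone v) (h0 : ∀ i, 0 ≤ v i) :
    toSeq Fin.valEmbedding v ∈ decreasingCone := by
  have hlt : ∀ k (hk : k < n), toSeq Fin.valEmbedding v k = v ⟨k, hk⟩ := fun k hk =>
    toSeq_apply Fin.valEmbedding v ⟨k, hk⟩
  have hge : ∀ k, n ≤ k → toSeq Fin.valEmbedding v k = 0 := fun k hk =>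
    toSeq_of_notMem _ _ (by rintro ⟨i, rfl⟩; exact absurd i.2 (not_lt.2 hk))
  have hnn : ∀ k, 0 ≤ toSeq Fin.valEmbedding v k := fun k => by
    rcases lt_or_ge k n with hk | hk
    · rw [hlt k hk]; exact h0 _
    · rw [hge k hk]
  refine ⟨fun i j hij => ?_, hnn⟩
  rcases lt_or_ge j n with hj | hj
  · change toSeq Fin.valEmbedding v j ≤ toSeq Fin.valEmbedding v i
    rw [hlt j hj, hlt i (hij.trans_lt hj)]
    exact hv hij
  · change toSeq Fin.valEmbedding v j ≤ toSeq Fin.valEmbedding v i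
    rw [hge j hj]
    exact hnn i

theorem decreasingRearrangement_eq_self {s : ℕ →₀ ℝ} (hs : s ∈ decreasingCone) (i : ℕ) :
    decreasingRearrangement s i = s i := by
  obtain ⟨hanti, h0⟩ := hs
  -- The support of a nonincreasing nonnegative sequence is an initial segment, so its list of
  -- values is already sorted.
  obtain ⟨N, hN⟩ : ∃ N, s.support = Finset.range N := by
    have hl : IsLowerSet (s.support : Set ℕ) := by
      intro a b hba ha
      rw [Finset.mem_coe, Finsupp.mem_support_iff] at ha ⊢
      have h1 := hanti hba
      have h2 := lt_of_le_of_ne (h0 a) (Ne.symm ha)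
      exact (h2.trans_le h1).ne'
    obtain ⟨N, hN⟩ := hl.eq_univ_or_Iio.resolve_left
      (fun h ↦ Set.infinite_univ.not_finite (h ▸ Finset.finite_toSet _))
    exact ⟨N, by rw [← Finset.coe_inj, hN, Finset.coe_range]⟩
  have hsort : ((s.support.val.map fun j => |s j|).sort (· ≥ ·)) = (List.range N).map s := by
    have h1 : (s.support.val.map fun j => |s j|) = (((List.range N).map s : List ℝ) :
        Multiset ℝ) := by
      rw [hN, Finset.range_val, ← Multiset.coe_range, Multiset.map_coe]
      congr 1
      exact List.map_congr_left fun j _ => abs_of_nonneg (h0 j)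
    rw [h1, Multiset.coe_sort]
    refine List.mergeSort_of_pairwise ?_
    rw [List.pairwise_map]
    refine List.Pairwise.imp ?_ List.pairwise_lt_range
    intro a b hab
    simpa using hanti hab.le
  rw [decreasingRearrangement, hsort]
  rcases lt_or_ge i N with hi | hi
  · rw [List.getD_eq_getElem _ _ (by simpa using hi)]
    simp
  · rw [List.getD_eq_default _ _ (by simpa using hi)]
    have : i ∉ s.support := by rw [hN]; simpa using hi
    exact (Finsupp.notMem_support_iff.1 this).symm

theorem sum_support_toSeq_mul (v : Fin n → ℝ) (ξ : ℕ →₀ ℝ) :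
    ∑ i ∈ ξ.support, toSeq Fin.valEmbedding v i * ξ i = ∑ i : Fin n, v i * ξ i := by
  classical
  have h1 : ∑ i : Fin n, v i * ξ i =
      ∑ i ∈ Finset.range n, toSeq Fin.valEmbedding v i * ξ i := by
    rw [Finset.sum_range]
    exact Finset.sum_congr rfl fun i _ => by
      rw [← toSeq_apply Fin.valEmbedding v i]; rfl
  rw [h1]
  trans ∑ i ∈ ξ.support ∪ Finset.range n, toSeq Fin.valEmbedding v i * ξ i
  · refine Finset.sum_subset Finset.subset_union_left fun i _ hi => ?_
    rw [Finsupp.notMem_support_iff.1 hi, mul_zero]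
  · refine (Finset.sum_subset Finset.subset_union_right fun i _ hi => ?_).symm
    rw [toSeq_of_notMem, zero_mul]
    rintro ⟨j, rfl⟩
    exact hi (Finset.mem_range.2 j.2)

/-- For sorted `v` the rearrangement in the adjoint disappears. This case suffices, since singular
values come sorted and other families can be permuted. -/
theorem snFun_snAdjoint_eq (hΦ : IsSNFunction (snAdjoint Θ)) {v : Fin n → ℝ} (hv : Antitone v)
    (h0 : ∀ i, 0 ≤ v i) : snFun (snAdjoint Θ) v =
      sSup {r : ℝ | ∃ ξ ∈ decreasingCone, ξ ≠ 0 ∧ r = (1 / Θ ξ) * ∑ i : Fin n, v i * ξ i} := by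
  rw [← hΦ.toSeq_eq Fin.valEmbedding, snAdjoint]
  simp only [decreasingRearrangement_eq_self (toSeq_mem_decreasingCone hv h0),
    sum_support_toSeq_mul]

theorem IsSNFunction.bddAbove_adjoint (hΘ : IsSNFunction Θ) {v : Fin n → ℝ} (h0 : ∀ i, 0 ≤ v i) :
    BddAbove {r : ℝ | ∃ ξ ∈ decreasingCone, ξ ≠ 0 ∧ r = (1 / Θ ξ) * ∑ i : Fin n, v i * ξ i} := by
  refine ⟨∑ i, v i, ?_⟩
  rintro _ ⟨ξ, -, hξ0, rfl⟩
  have hpos : 0 < Θ ξ := lt_of_le_of_ne (hΘ.nonneg ξ) fun h => hξ0 (hΘ.eq_zero ξ h.symm)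
  rw [one_div, inv_mul_le_iff₀ hpos, Finset.mul_sum]
  refine Finset.sum_le_sum fun i _ => ?_
  have h1 : ξ i ≤ Θ ξ := (le_abs_self _).trans
    ((hΘ.abs_le_snFun (fun i : Fin n => ξ i) i).trans (hΘ.snFun_restrict_le ξ n))
  nlinarith [h0 i]

theorem exists_perm_antitone_abs (w : Fin n → ℝ) :
    ∃ σ : Equiv.Perm (Fin n), Antitone fun i => |w (σ i)| := by
  refine ⟨Tuple.sort fun i => -|w i|, fun i j hij => ?_⟩
  have := Tuple.monotone_sort (fun i => -|w i|) hij
  simpa using this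

/-- Hölder's inequality for `Θ` and its adjoint. Test vectors in the adjoint must be nonincreasing;
by the rearrangement inequality, sorting `|w|` only increases the pairing with the sorted `v`. -/
theorem sum_mul_abs_le_snAdjoint (hΘ : IsSNFunction Θ) (hΦ : IsSNFunction (snAdjoint Θ))
    {v : Fin n → ℝ} (hv : Antitone v) (h0 : ∀ i, 0 ≤ v i) (w : Fin n → ℝ) :
    ∑ i, v i * |w i| ≤ snFun (snAdjoint Θ) v * snFun Θ w := by
  obtain ⟨σ, hσ⟩ := exists_perm_antitone_abs w
  let u : Fin n → ℝ := fun i => |w (σ i)|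
  have hu : snFun Θ u = snFun Θ w := by
    rw [← hΘ.snFun_comp_equiv σ w]
    exact hΘ.snFun_congr_abs fun i => by simp [u]
  have h1 : ∑ i, v i * |w i| ≤ ∑ i, v i * u i := by
    have hmono : Monovary v u := fun i j hij => hv (le_of_not_ge fun h =>
      absurd (hσ h) (not_le.2 hij))
    simpa [u] using hmono.sum_mul_comp_perm_le_sum_mul (σ := σ⁻¹)
  refine h1.trans ?_
  rw [← hu, ← hΘ.toSeq_eq Fin.valEmbedding u]
  by_cases hξ : toSeq Fin.valEmbedding u = 0
  · have : ∀ i, u i = 0 := fun i => by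
      rw [← toSeq_apply Fin.valEmbedding u i, hξ]; rfl
    simpa [this] using mul_nonneg (hΦ.snFun_nonneg v) (hΘ.nonneg _)
  · have hpos : 0 < Θ (toSeq Fin.valEmbedding u) :=
      lt_of_le_of_ne (hΘ.nonneg _) fun h => hξ (hΘ.eq_zero _ h.symm)
    have h2 := le_csSup (hΘ.bddAbove_adjoint h0) ⟨toSeq Fin.valEmbedding u,
      toSeq_mem_decreasingCone hσ fun i => abs_nonneg _, hξ, rfl⟩
    rw [← snFun_snAdjoint_eq hΦ hv h0, one_div, inv_mul_le_iff₀ hpos] at h2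
    have h3 : ∑ i : Fin n, v i * u i = ∑ i : Fin n, v i * toSeq Fin.valEmbedding u i :=
      Finset.sum_congr rfl fun i _ => by rw [← toSeq_apply Fin.valEmbedding u i]; rfl
    rw [h3, mul_comm]
    exact h2

/-- Norming vectors up to a factor `c < 1`: this needs only the definition of the supremum and no
compactness argument for attaining it. -/
theorem exists_le_sum_mul_of_lt_one (hΘ : IsSNFunction Θ) (hΦ : IsSNFunction (snAdjoint Θ))
    {v : Fin n → ℝ} (hv : Antitone v) (h0 : ∀ i, 0 ≤ v i) {c : ℝ} (hc : c < 1) :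
    ∃ w : Fin n → ℝ, snFun Θ w ≤ 1 ∧ c * snFun (snAdjoint Θ) v ≤ ∑ i, v i * w i := by
  rcases (hΦ.snFun_nonneg v).eq_or_lt with h | h
  · exact ⟨0, by simp [hΘ.snFun_zero], by simp [← h]⟩
  have hlt : c * snFun (snAdjoint Θ) v < snFun (snAdjoint Θ) v := by nlinarith
  have heq := snFun_snAdjoint_eq hΦ hv h0
  have hne : {r : ℝ | ∃ ξ ∈ decreasingCone, ξ ≠ 0 ∧
      r = (1 / Θ ξ) * ∑ i : Fin n, v i * ξ i}.Nonempty := by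
    by_contra hne
    rw [Set.not_nonempty_iff_eq_empty] at hne
    rw [heq, hne, Real.sSup_empty] at h
    exact lt_irrefl _ h
  obtain ⟨_, ⟨ξ, -, hξ0, rfl⟩, hr⟩ := exists_lt_of_lt_csSup hne (heq ▸ hlt)
  have hpos : 0 < Θ ξ := lt_of_le_of_ne (hΘ.nonneg ξ) fun h => hξ0 (hΘ.eq_zero ξ h.symm)
  refine ⟨(Θ ξ)⁻¹ • fun i : Fin n => ξ i, ?_, ?_⟩
  · rw [hΘ.snFun_smul, abs_of_pos (inv_pos.2 hpos), inv_mul_le_iff₀ hpos, mul_one]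
    exact hΘ.snFun_restrict_le ξ n
  · rw [heq]
    refine hr.le.trans (le_of_eq ?_)
    rw [one_div, Finset.mul_sum]
    exact Finset.sum_congr rfl fun i _ => by
      rw [Pi.smul_apply, smul_eq_mul]
      ring

/-- Q-norms are dominated by Q*-norms. -/
theorem IsQNorm.le_of_isQStarNorm (hΨ : IsQNorm Ψ) (hΦ : IsQStarNorm Φ) (a : ℕ →₀ ℝ) :
    Ψ a ≤ Φ a := by
  obtain ⟨hΦ, Θ, hΘ, rfl⟩ := hΦ
  obtain ⟨N, hN⟩ := exists_eq_toSeq_fin a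
  rw [hN N le_rfl, hΨ.1.toSeq_eq, hΦ.toSeq_eq]
  set v : Fin N → ℝ := fun i => a i
  obtain ⟨σ, hσ⟩ := exists_perm_antitone_abs v
  let u : Fin N → ℝ := fun i => |v (σ i)|
  have hu : ∀ {Λ : (ℕ →₀ ℝ) → ℝ}, IsSNFunction Λ → snFun Λ v = snFun Λ u := fun hΛ => by
    rw [← hΛ.snFun_comp_equiv σ v]
    exact hΛ.snFun_congr_abs fun i => by simp [u]
  rw [hu hΨ.1, hu hΦ]
  have h1 := hΨ.snFun_sq_le_sum u
  have h2 := hΘ.snFun_sq_le_sum u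
  -- Pairing `u` with itself gives `‖u‖₂² ≤ f * t`, while `t ≤ ‖u‖₂` and `p ≤ ‖u‖₂`. Hence `t ≤ f`,
  -- and so `p² ≤ ‖u‖₂² ≤ f²`.
  have h3 := sum_mul_abs_le_snAdjoint hΘ.1 hΦ (v := u) hσ (fun i => abs_nonneg _) u
  have h4 : ∑ i, u i * |u i| = ∑ i, u i ^ 2 := Finset.sum_congr rfl fun i _ => by
    simp [u, sq]
  rw [h4] at h3
  have hp := hΨ.1.snFun_nonneg u
  have hf := hΦ.snFun_nonneg u
  have ht := hΘ.1.snFun_nonneg u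
  generalize snFun Ψ u = p at *
  generalize snFun (snAdjoint Θ) u = f at *
  generalize snFun Θ u = t at *
  have htf : t ≤ f := by
    by_contra h
    push Not at h
    nlinarith
  refine le_of_sq_le_sq (h1.trans (h3.trans ?_)) hf
  nlinarith

/-! ### Trace duality and the lower Pythagorean estimate -/

theorem sv_antitone (x : Matrix (Fin n) (Fin n) ℂ) : Antitone (sv x) := fun _ _ hij =>
  LinearMap.singularValues_antitone _ hij

/-- With `x = U D V`, cyclicity of the trace pairs the singular values of `x` with the diagonal of
`V * z * U`, and Hölder for sequences applies. -/
theorem re_trace_mul_le (hΘ : IsSNFunction Θ) (hΦ : IsSNFunction (snAdjoint Θ))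
    (x z : Matrix (Fin n) (Fin n) ℂ) :
    (x * z).trace.re ≤ symmNorm (snAdjoint Θ) x * symmNorm Θ z := by
  obtain ⟨U, hU, V, hV, hx⟩ := exists_svd x
  have h1 : (x * z).trace = ∑ i, (sv x i : ℂ) * (V * z * U) i i := by
    conv_lhs => rw [hx]
    rw [mul_assoc, mul_assoc, Matrix.trace_mul_comm, mul_assoc, Matrix.trace]
    simp only [Matrix.diag_apply, Matrix.diagonal_mul]
  calc (x * z).trace.re ≤ ‖(x * z).trace‖ := Complex.re_le_norm _
    _ ≤ ∑ i, sv x i * |‖(V * z * U) i i‖| := by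
        rw [h1]
        refine (norm_sum_le _ _).trans (Finset.sum_le_sum fun i _ => le_of_eq ?_)
        rw [norm_mul, Complex.norm_real, Real.norm_eq_abs, abs_of_nonneg (sv_nonneg x i), abs_norm]
    _ ≤ snFun (snAdjoint Θ) (sv x) * snFun Θ (fun i => ‖(V * z * U) i i‖) :=
        sum_mul_abs_le_snAdjoint hΘ hΦ (sv_antitone x) (sv_nonneg x) _
    _ ≤ symmNorm (snAdjoint Θ) x * symmNorm Θ z := by
        rw [hΦ.symmNorm_eq]
        refine mul_le_mul_of_nonneg_left ?_ (hΦ.snFun_nonneg _)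
        exact hΘ.snFun_diag_le V z U (norm_le_one_of_mem_unitary hV) (norm_le_one_of_mem_unitary hU)

theorem exists_le_re_trace_mul (hΘ : IsSNFunction Θ) (hΦ : IsSNFunction (snAdjoint Θ))
    (x : Matrix (Fin n) (Fin n) ℂ) {c : ℝ} (hc : c < 1) :
    ∃ z : Matrix (Fin n) (Fin n) ℂ, symmNorm Θ z ≤ 1 ∧
      c * symmNorm (snAdjoint Θ) x ≤ (x * z).trace.re := by
  obtain ⟨U, hU, V, hV, hx⟩ := exists_svd x
  obtain ⟨w, hw, hcw⟩ := exists_le_sum_mul_of_lt_one hΘ hΦ (sv_antitone x) (sv_nonneg x) hc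
  have hV' : V * V.conjTranspose = 1 := Matrix.mem_unitaryGroup_iff.1 hV
  have hU' : U.conjTranspose * U = 1 := Matrix.mem_unitaryGroup_iff'.1 hU
  refine ⟨V.conjTranspose * Matrix.diagonal (fun i => (w i : ℂ)) * U.conjTranspose, ?_, ?_⟩
  · refine (hΘ.symmNorm_mul_diagonal_mul_le _ _ _ ?_ ?_).trans hw <;>
      rw [Matrix.l2_opNorm_conjTranspose]
    · exact norm_le_one_of_mem_unitary hV
    · exact norm_le_one_of_mem_unitary hU
  · have h : (x * (V.conjTranspose * Matrix.diagonal (fun i => (w i : ℂ)) *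
        U.conjTranspose)).trace = ((∑ i, sv x i * w i : ℝ) : ℂ) := by
      conv_lhs => rw [hx]
      simp only [mul_assoc]
      rw [← mul_assoc V, hV', one_mul, Matrix.trace_mul_comm]
      simp only [mul_assoc]
      rw [hU', mul_one, Matrix.diagonal_mul_diagonal, Matrix.trace_diagonal]
      push_cast
      rfl
    rw [h, Complex.ofReal_re, hΦ.symmNorm_eq]
    exact hcw

theorem norm_le_one_of_isSelfAdjoint_idempotent {P : Matrix (Fin n) (Fin n) ℂ}
    (hP : P.conjTranspose = P) (hPP : P * P = P) : ‖P‖ ≤ 1 := by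
  have h := Matrix.l2_opNorm_conjTranspose_mul_self P
  rw [hP, hPP] at h
  nlinarith [norm_nonneg P]

/-- Q*-norms satisfy a lower Pythagorean estimate. -/
theorem IsQStarNorm.add_sq_le (hΦ : IsQStarNorm Φ) {P : Matrix (Fin n) (Fin n) ℂ}
    (hP : P.conjTranspose = P) (hPP : P * P = P) (x : Matrix (Fin n) (Fin n) ℂ) :
    symmNorm Φ (x * P) ^ 2 + symmNorm Φ (x * (1 - P)) ^ 2 ≤ symmNorm Φ x ^ 2 := by
  obtain ⟨hΦ, Θ, hΘ, rfl⟩ := hΦ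
  have hQ : (1 - P).conjTranspose = 1 - P := by rw [Matrix.conjTranspose_sub, hP]; simp
  have hQQ : (1 - P) * (1 - P) = 1 - P := by
    rw [mul_sub, mul_one, sub_mul, hPP, one_mul, sub_self, sub_zero]
  have hPQ : P * (1 - P) = 0 := by rw [mul_sub, hPP, mul_one, sub_self]
  have hQP : (1 - P) * P = 0 := by rw [sub_mul, hPP, one_mul, sub_self]
  have nP := norm_le_one_of_isSelfAdjoint_idempotent hP hPP
  have nQ := norm_le_one_of_isSelfAdjoint_idempotent hQ hQQ
  have hsum : P.conjTranspose * P + (1 - P).conjTranspose * (1 - P) = 1 := by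
    rw [hP, hQ, hPP, hQQ, add_sub_cancel]
  generalize 1 - P = Q at *
  have ha := hΦ.symmNorm_nonneg (x * P)
  have hb := hΦ.symmNorm_nonneg (x * Q)
  generalize ha' : symmNorm (snAdjoint Θ) (x * P) = a at *
  generalize hb' : symmNorm (snAdjoint Θ) (x * Q) = b at *
  have key : ∀ c < 1, c * √(a ^ 2 + b ^ 2) ≤ symmNorm (snAdjoint Θ) x := by
    intro c hc
    obtain ⟨z₁, hz₁, h₁⟩ := exists_le_re_trace_mul hΘ.1 hΦ (x * P) hc
    obtain ⟨z₂, hz₂, h₂⟩ := exists_le_re_trace_mul hΘ.1 hΦ (x * Q) hc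
    rw [ha'] at h₁
    rw [hb'] at h₂
    -- Near-norming matrices of the two pieces, weighted by the norms of the pieces. The upper
    -- estimate for the Q-norm `Θ` gives `z` norm at most `√(a² + b²)`, while its pairing with `x`
    -- is at least `c (a² + b²)`.
    let z := (a : ℂ) • (P * z₁) + (b : ℂ) • (Q * z₂)
    have hPz : P * z = (a : ℂ) • (P * z₁ * 1) := by
      simp only [z, mul_add, mul_smul_comm, ← mul_assoc, hPP, hPQ, zero_mul, smul_zero, add_zero,
        mul_one]
    have hQz : Q * z = (b : ℂ) • (Q * z₂ * 1) := by
      simp only [z, mul_add, mul_smul_comm, ← mul_assoc, hQQ, hQP, zero_mul, smul_zero, zero_add,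
        mul_one]
    have nz₁ : symmNorm Θ (P * z) ≤ a := by
      rw [hPz, hΘ.1.symmNorm_smul, Complex.norm_real, Real.norm_eq_abs, abs_of_nonneg ha]
      refine mul_le_of_le_one_right ha (le_trans ?_ hz₁)
      -- The identity matrix has norm one only for `n ≠ 0`; for `n = 0` all matrices coincide.
      rcases isEmpty_or_nonempty (Fin n) with h | h
      · exact le_of_eq (congrArg _ (Matrix.ext fun i => h.elim i))
      · exact hΘ.1.symmNorm_mul_mul_le_of_norm_le_one P z₁ 1 nP norm_one.le
    have nz₂ : symmNorm Θ (Q * z) ≤ b := by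
      rw [hQz, hΘ.1.symmNorm_smul, Complex.norm_real, Real.norm_eq_abs, abs_of_nonneg hb]
      refine mul_le_of_le_one_right hb (le_trans ?_ hz₂)
      rcases isEmpty_or_nonempty (Fin n) with h | h
      · exact le_of_eq (congrArg _ (Matrix.ext fun i => h.elim i))
      · exact hΘ.1.symmNorm_mul_mul_le_of_norm_le_one Q z₂ 1 nQ norm_one.le
    have nz : symmNorm Θ z ≤ √(a ^ 2 + b ^ 2) := by
      refine Real.le_sqrt_of_sq_le ((hΘ.symmNorm_sq_le hsum z).trans ?_)
      exact add_le_add (pow_le_pow_left₀ (hΘ.1.symmNorm_nonneg _) nz₁ 2)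
        (pow_le_pow_left₀ (hΘ.1.symmNorm_nonneg _) nz₂ 2)
    have htr : (x * z).trace.re = a * (x * P * z₁).trace.re + b * (x * Q * z₂).trace.re := by
      simp only [z, mul_add, Matrix.mul_smul, Matrix.trace_add, Matrix.trace_smul, ← mul_assoc,
        Complex.add_re, smul_eq_mul, Complex.re_ofReal_mul]
    have hle := re_trace_mul_le hΘ.1 hΦ x z
    have h3 : c * (√(a ^ 2 + b ^ 2) * √(a ^ 2 + b ^ 2)) ≤
        symmNorm (snAdjoint Θ) x * √(a ^ 2 + b ^ 2) := by
      rw [Real.mul_self_sqrt (by positivity)]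
      calc c * (a ^ 2 + b ^ 2) = a * (c * a) + b * (c * b) := by ring
        _ ≤ (x * z).trace.re := by
            rw [htr]
            exact add_le_add (mul_le_mul_of_nonneg_left h₁ ha) (mul_le_mul_of_nonneg_left h₂ hb)
        _ ≤ _ := hle.trans (mul_le_mul_of_nonneg_left nz (hΦ.symmNorm_nonneg x))
    rcases (Real.sqrt_nonneg (a ^ 2 + b ^ 2)).eq_or_lt with h | h
    · rw [← h, mul_zero]; exact hΦ.symmNorm_nonneg x
    · rw [← mul_assoc] at h3
      exact le_of_mul_le_mul_right h3 h
  have hcont : Continuous fun c : ℝ => c * √(a ^ 2 + b ^ 2) := by fun_prop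
  have hlim : Filter.Tendsto (fun c : ℝ => c * √(a ^ 2 + b ^ 2))
      (nhdsWithin 1 (Set.Iio 1)) (nhds (√(a ^ 2 + b ^ 2))) := by
    simpa using (hcont.tendsto 1).mono_left nhdsWithin_le_nhds
  have hfin : √(a ^ 2 + b ^ 2) ≤ symmNorm (snAdjoint Θ) x :=
    le_of_tendsto hlim (by filter_upwards [self_mem_nhdsWithin] with c hc using key c hc)
  exact (Real.sqrt_le_iff.1 hfin).2

end QNorms

/-! ### Block diagonal matrices over `H` -/

section Blocks

theorem scalarSandwich_scalarSandwich {E : Type*} [AddCommGroup E] [Module ℂ E] {k m n : ℕ}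
    (a : Matrix (Fin n) (Fin m) ℂ) (b : Matrix (Fin m) (Fin k) ℂ) (x : Matrix (Fin k) (Fin k) E)
    (c : Matrix (Fin k) (Fin m) ℂ) (d : Matrix (Fin m) (Fin n) ℂ) :
    scalarSandwich a (scalarSandwich b x c) d = scalarSandwich (a * b) x (c * d) := by
  ext i j
  let F : Fin m → Fin m → Fin k → Fin k → E := fun p q r s =>
    (a i p * d q j * (b p r * c s q)) • x r s
  have h1 : scalarSandwich a (scalarSandwich b x c) d i j = ∑ p, ∑ q, ∑ r, ∑ s, F p q r s := by
    simp only [scalarSandwich, Matrix.of_apply, Finset.smul_sum, smul_smul, F]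
  have h2 : scalarSandwich (a * b) x (c * d) i j = ∑ r, ∑ s, ∑ q, ∑ p, F p q r s := by
    simp only [scalarSandwich, Matrix.of_apply, Matrix.mul_apply, Finset.sum_mul, Finset.mul_sum,
      Finset.sum_smul, F]
    refine Finset.sum_congr rfl fun r _ => Finset.sum_congr rfl fun s _ =>
      Finset.sum_congr rfl fun q _ => Finset.sum_congr rfl fun p _ => ?_
    congr 1
    ring
  rw [h1, h2]
  simp only [← Fintype.sum_prod_type']
  exact Fintype.sum_equiv ⟨fun z => ⟨z.2.2.1, z.2.2.2, z.2.1, z.1⟩,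
    fun z => ⟨z.2.2.2, z.2.2.1, z.1, z.2.1⟩, fun _ => rfl, fun _ => rfl⟩ _ _ fun _ => rfl

theorem scalarSandwich_one {E : Type*} [AddCommGroup E] [Module ℂ E] {n : ℕ}
    (x : Matrix (Fin n) (Fin n) E) : scalarSandwich 1 x 1 = x := by
  ext i j
  simp [scalarSandwich, Matrix.one_apply]

theorem scalarSandwich_add {E : Type*} [AddCommGroup E] [Module ℂ E] {m n : ℕ}
    (a : Matrix (Fin n) (Fin m) ℂ) (x y : Matrix (Fin m) (Fin m) E)
    (b : Matrix (Fin m) (Fin n) ℂ) :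
    scalarSandwich a (x + y) b = scalarSandwich a x b + scalarSandwich a y b := by
  ext i j
  simp [scalarSandwich, smul_add, Finset.sum_add_distrib]

theorem scalarSandwich_zero_left {E : Type*} [AddCommGroup E] [Module ℂ E] {m n : ℕ}
    (x : Matrix (Fin m) (Fin m) E) (b : Matrix (Fin m) (Fin n) ℂ) :
    scalarSandwich (0 : Matrix (Fin n) (Fin m) ℂ) x b = 0 := by
  ext i j
  simp [scalarSandwich]

/-- The isometry of `ℂᵐ` onto the first summand of `ℂᵐ⁺ⁿ`. -/
def inlMatrix (m n : ℕ) : Matrix (Fin (m + n)) (Fin m) ℂ :=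
  Matrix.of fun i j => if i = Fin.castAdd n j then 1 else 0

/-- The isometry of `ℂⁿ` onto the second summand of `ℂᵐ⁺ⁿ`. -/
def inrMatrix (m n : ℕ) : Matrix (Fin (m + n)) (Fin n) ℂ :=
  Matrix.of fun i j => if i = Fin.natAdd m j then 1 else 0

theorem conjTranspose_inlMatrix_mul_self (m n : ℕ) :
    (inlMatrix m n).conjTranspose * inlMatrix m n = 1 := by
  ext i j
  simp [inlMatrix, Matrix.mul_apply, Matrix.one_apply, eq_comm]

theorem conjTranspose_inrMatrix_mul_self (m n : ℕ) :
    (inrMatrix m n).conjTranspose * inrMatrix m n = 1 := by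
  ext i j
  simp [inrMatrix, Matrix.mul_apply, Matrix.one_apply, eq_comm]

theorem castAdd_ne_natAdd {m n : ℕ} (i : Fin m) (j : Fin n) :
    Fin.castAdd n i ≠ Fin.natAdd m j := fun h => by
  have := congrArg Fin.val h
  simp at this
  omega

theorem conjTranspose_inlMatrix_mul_inrMatrix (m n : ℕ) :
    (inlMatrix m n).conjTranspose * inrMatrix m n = 0 := by
  ext i j
  simp [inlMatrix, inrMatrix, Matrix.mul_apply, (castAdd_ne_natAdd i j).symm]

theorem conjTranspose_inrMatrix_mul_inlMatrix (m n : ℕ) :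
    (inrMatrix m n).conjTranspose * inlMatrix m n = 0 := by
  simpa using congrArg Matrix.conjTranspose (conjTranspose_inlMatrix_mul_inrMatrix m n)

theorem inlMatrix_mul_add_inrMatrix_mul (m n : ℕ) :
    inlMatrix m n * (inlMatrix m n).conjTranspose +
      inrMatrix m n * (inrMatrix m n).conjTranspose = 1 := by
  ext i j
  refine Fin.addCases (fun i => ?_) (fun i => ?_) i <;>
    refine Fin.addCases (fun j => ?_) (fun j => ?_) j <;>
    simp [inlMatrix, inrMatrix, Matrix.mul_apply, Matrix.one_apply, castAdd_ne_natAdd,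
      (castAdd_ne_natAdd _ _).symm]

theorem blockDiag_eq {E : Type*} [AddCommGroup E] [Module ℂ E] {m n : ℕ}
    (x : Matrix (Fin m) (Fin m) E) (y : Matrix (Fin n) (Fin n) E) :
    blockDiag x y = scalarSandwich (inlMatrix m n) x (inlMatrix m n).conjTranspose +
      scalarSandwich (inrMatrix m n) y (inrMatrix m n).conjTranspose := by
  ext i j
  refine Fin.addCases (fun i => ?_) (fun i => ?_) i <;>
    refine Fin.addCases (fun j => ?_) (fun j => ?_) j <;>
    simp [blockDiag, scalarSandwich, inlMatrix, inrMatrix, castAdd_ne_natAdd,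
      (castAdd_ne_natAdd _ _).symm]

/-! ### The maximum formula for orthogonal corners -/

variable {H : Type*} [NormedAddCommGroup H] [InnerProductSpace ℂ H] {n : ℕ}
  {Φ Ψ : (ℕ →₀ ℝ) → ℝ}

/-- With `T` and `S` in orthogonal corners, `ρ_{T+S}` maps each of the four blocks of `x` to the
same block with norm at most `M ^ 2`. Hence `‖ρ(x)‖_Ψ² ≤ ∑ ‖blocks of ρ(x)‖_Ψ² ≤ M⁴ ∑ ‖blocks of
x‖_Φ² ≤ M⁴ ‖x‖_Φ²`; the outer steps are the two Pythagorean estimates. -/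
theorem hilbertNorm_add_le_max (hΦ : IsQStarNorm Φ) (hΨ : IsQNorm Ψ)
    {P : Matrix (Fin n) (Fin n) ℂ} (hP : P.conjTranspose = P) (hPP : P * P = P)
    {T S : Matrix (Fin n) (Fin n) H} (hT : scalarSandwich P T P = T)
    (hS : scalarSandwich (1 - P) S (1 - P) = S) :
    hilbertNorm H Φ Ψ n (T + S) ≤ max (hilbertNorm H Φ Ψ n T) (hilbertNorm H Φ Ψ n S) := by
  have hle := hΨ.le_of_isQStarNorm hΦ
  have hQ : (1 - P).conjTranspose = 1 - P := by rw [Matrix.conjTranspose_sub, hP]; simp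
  have hQQ : (1 - P) * (1 - P) = 1 - P := by
    rw [mul_sub, mul_one, sub_mul, hPP, one_mul, sub_self, sub_zero]
  have hPQ : P * (1 - P) = 0 := by rw [mul_sub, hPP, mul_one, sub_self]
  have hQP : (1 - P) * P = 0 := by rw [sub_mul, hPP, one_mul, sub_self]
  have hsum : P.conjTranspose * P + (1 - P).conjTranspose * (1 - P) = 1 := by
    rw [hP, hQ, hPP, hQQ, add_sub_cancel]
  have hsum' : P * P.conjTranspose + (1 - P) * (1 - P).conjTranspose = 1 := by
    rw [hP, hQ, hPP, hQQ, add_sub_cancel]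
  have hcol := fun x : Matrix (Fin n) (Fin n) ℂ => hΦ.add_sq_le hP hPP x
  have hrow : ∀ x : Matrix (Fin n) (Fin n) ℂ,
      symmNorm Φ (P * x) ^ 2 + symmNorm Φ ((1 - P) * x) ^ 2 ≤ symmNorm Φ x ^ 2 := fun x => by
    have h := hcol x.conjTranspose
    have e1 : x.conjTranspose * P = (P * x).conjTranspose := by
      rw [Matrix.conjTranspose_mul, hP]
    have e2 : x.conjTranspose * (1 - P) = ((1 - P) * x).conjTranspose := by
      rw [Matrix.conjTranspose_mul, hQ]
    rwa [e1, e2, hΦ.1.symmNorm_conjTranspose, hΦ.1.symmNorm_conjTranspose,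
      hΦ.1.symmNorm_conjTranspose] at h
  have n1 := symmNorm_rhoMap_le_hilbertNorm hΦ.1 hΨ.1 hle T
  have n2 := symmNorm_rhoMap₂_le_hilbertNorm hΦ.1 hΨ.1 hle T S
  have n3 := symmNorm_rhoMap₂_le_hilbertNorm hΦ.1 hΨ.1 hle S T
  have n4 := symmNorm_rhoMap_le_hilbertNorm hΦ.1 hΨ.1 hle S
  have hTM : hilbertNorm H Φ Ψ n T ≤ max (hilbertNorm H Φ Ψ n T) (hilbertNorm H Φ Ψ n S) :=
    le_max_left _ _
  have hSM : hilbertNorm H Φ Ψ n S ≤ max (hilbertNorm H Φ Ψ n T) (hilbertNorm H Φ Ψ n S) :=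
    le_max_right _ _
  have hT0 := hilbertNorm_nonneg (Φ := Φ) (Ψ := Ψ) T
  have hS0 := hilbertNorm_nonneg (Φ := Φ) (Ψ := Ψ) S
  refine hilbertNorm_le hΦ.1 (hT0.trans hTM) fun x => ?_
  generalize max (hilbertNorm H Φ Ψ n T) (hilbertNorm H Φ Ψ n S) = M at *
  generalize hilbertNorm H Φ Ψ n T = t at *
  generalize hilbertNorm H Φ Ψ n S = s at *
  have hM0 : 0 ≤ M := hT0.trans hTM
  -- The corner conditions on `T` and `S` show that each of the four maps sees one block of `x` only
  -- and has values in that block only.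
  have e1 : rhoMap T x = P * rhoMap T (P * x * P) * P := by
    have h := rhoMap_scalarSandwich P P T x
    rwa [hT, hP] at h
  have e2 : rhoMap₂ T S x = P * rhoMap₂ T S (P * x * (1 - P)) * (1 - P) := by
    have h := rhoMap₂_scalarSandwich P (1 - P) P (1 - P) T S x
    rwa [hT, hS, hQ] at h
  have e3 : rhoMap₂ S T x = (1 - P) * rhoMap₂ S T ((1 - P) * x * P) * P := by
    have h := rhoMap₂_scalarSandwich (1 - P) P (1 - P) P S T x
    rwa [hT, hS, hP] at h
  have e4 : rhoMap S x = (1 - P) * rhoMap S ((1 - P) * x * (1 - P)) * (1 - P) := by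
    have h := rhoMap_scalarSandwich (1 - P) (1 - P) S x
    rwa [hS, hQ] at h
  have nP := norm_le_one_of_isSelfAdjoint_idempotent hP hPP
  have nQ := norm_le_one_of_isSelfAdjoint_idempotent hQ hQQ
  have hadd := rhoMap_add T S x
  rw [e1, e2, e3, e4] at hadd
  generalize 1 - P = Q at *
  have rPP : ∀ y, P * (P * y) = P * y := fun y => by rw [← mul_assoc, hPP]
  have rPQ : ∀ y, P * (Q * y) = 0 := fun y => by rw [← mul_assoc, hPQ, zero_mul]
  have rQP : ∀ y, Q * (P * y) = 0 := fun y => by rw [← mul_assoc, hQP, zero_mul]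
  have rQQ : ∀ y, Q * (Q * y) = Q * y := fun y => by rw [← mul_assoc, hQQ]
  have bound : ∀ {a b y z : Matrix (Fin n) (Fin n) ℂ} {p q : ℝ}, ‖a‖ ≤ 1 → ‖b‖ ≤ 1 →
      0 ≤ p → p ≤ M → 0 ≤ q → q ≤ M → symmNorm Ψ y ≤ p * q * symmNorm Φ z →
      symmNorm Ψ (a * y * b) ≤ M ^ 2 * symmNorm Φ z := by
    intro a b y z p q ha hb hp hpM hq hqM h
    refine (hΨ.1.symmNorm_mul_mul_le_of_norm_le_one a y b ha hb).trans (h.trans ?_)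
    rw [sq]
    exact mul_le_mul_of_nonneg_right (mul_le_mul hpM hqM hq hM0) (hΦ.1.symmNorm_nonneg z)
  have i1 : symmNorm Ψ (P * rhoMap (T + S) x * P) ≤ M ^ 2 * symmNorm Φ (P * x * P) := by
    have h : P * rhoMap (T + S) x * P = P * rhoMap T (P * x * P) * P := by
      rw [hadd]
      simp only [mul_add, add_mul, mul_assoc, rPP, rPQ, hPP, hQP, mul_zero, add_zero]
    rw [h]
    exact bound nP nP hT0 hTM hT0 hTM ((n1 _).trans_eq (by rw [sq]))
  have i2 : symmNorm Ψ (P * rhoMap (T + S) x * Q) ≤ M ^ 2 * symmNorm Φ (P * x * Q) := by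
    have h : P * rhoMap (T + S) x * Q = P * rhoMap₂ T S (P * x * Q) * Q := by
      rw [hadd]
      simp only [mul_add, add_mul, mul_assoc, rPP, rPQ, hPQ, hQQ, mul_zero, add_zero, zero_add]
    rw [h]
    exact bound nP nQ hT0 hTM hS0 hSM (n2 _)
  have i3 : symmNorm Ψ (Q * rhoMap (T + S) x * P) ≤ M ^ 2 * symmNorm Φ (Q * x * P) := by
    have h : Q * rhoMap (T + S) x * P = Q * rhoMap₂ S T (Q * x * P) * P := by
      rw [hadd]
      simp only [mul_add, add_mul, mul_assoc, rQP, rQQ, hPP, hQP, mul_zero, add_zero, zero_add]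
    rw [h]
    exact bound nQ nP hS0 hSM hT0 hTM (n3 _)
  have i4 : symmNorm Ψ (Q * rhoMap (T + S) x * Q) ≤ M ^ 2 * symmNorm Φ (Q * x * Q) := by
    have h : Q * rhoMap (T + S) x * Q = Q * rhoMap S (Q * x * Q) * Q := by
      rw [hadd]
      simp only [mul_add, add_mul, mul_assoc, rQP, rQQ, hPQ, hQQ, mul_zero, zero_add]
    rw [h]
    exact bound nQ nQ hS0 hSM hS0 hSM ((n4 _).trans_eq (by rw [sq]))
  have j0 := hΨ.symmNorm_sq_le hsum (rhoMap (T + S) x)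
  have j1 := hΨ.symmNorm_sq_le_right hsum' (P * rhoMap (T + S) x)
  have j2 := hΨ.symmNorm_sq_le_right hsum' (Q * rhoMap (T + S) x)
  have k0 := hrow x
  have k1 := hcol (P * x)
  have k2 := hcol (Q * x)
  have sq : ∀ {y z : Matrix (Fin n) (Fin n) ℂ}, symmNorm Ψ y ≤ M ^ 2 * symmNorm Φ z →
      symmNorm Ψ y ^ 2 ≤ (M ^ 2) ^ 2 * symmNorm Φ z ^ 2 := fun h => by
    rw [← mul_pow]
    exact pow_le_pow_left₀ (hΨ.1.symmNorm_nonneg _) h 2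
  have l1 := sq i1
  have l2 := sq i2
  have l3 := sq i3
  have l4 := sq i4
  refine le_of_sq_le_sq ?_ (mul_nonneg (sq_nonneg M) (hΦ.1.symmNorm_nonneg x))
  rw [mul_pow]
  have k3 : (M ^ 2) ^ 2 * (symmNorm Φ (P * x * P) ^ 2 + symmNorm Φ (P * x * Q) ^ 2 +
      (symmNorm Φ (Q * x * P) ^ 2 + symmNorm Φ (Q * x * Q) ^ 2)) ≤
      (M ^ 2) ^ 2 * symmNorm Φ x ^ 2 :=
    mul_le_mul_of_nonneg_left (by linarith) (by positivity)
  linarith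

theorem norm_inlMatrix_le (m n : ℕ) : ‖inlMatrix m n‖ ≤ 1 :=
  norm_le_one_of_conjTranspose_mul_self (conjTranspose_inlMatrix_mul_self m n)

theorem norm_inrMatrix_le (m n : ℕ) : ‖inrMatrix m n‖ ≤ 1 :=
  norm_le_one_of_conjTranspose_mul_self (conjTranspose_inrMatrix_mul_self m n)

theorem hilbertNorm_scalarSandwich_le_of_norm_le_one {m n : ℕ} (hΦ : IsSNFunction Φ)
    (hΨ : IsSNFunction Ψ) (hle : ∀ a, Ψ a ≤ Φ a) {a : Matrix (Fin n) (Fin m) ℂ}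
    (ha : ‖a‖ ≤ 1) (T : Matrix (Fin m) (Fin m) H) :
    hilbertNorm H Φ Ψ n (scalarSandwich a T a.conjTranspose) ≤ hilbertNorm H Φ Ψ m T := by
  refine (hilbertNorm_scalarSandwich_le hΦ hΨ hle _ _ _).trans ?_
  rw [Matrix.l2_opNorm_conjTranspose]
  have h0 := hilbertNorm_nonneg (Φ := Φ) (Ψ := Ψ) T
  calc ‖a‖ * hilbertNorm H Φ Ψ m T * ‖a‖ ≤ 1 * hilbertNorm H Φ Ψ m T * 1 :=
        mul_le_mul (mul_le_mul_of_nonneg_right ha h0) ha (norm_nonneg _) (by simpa using h0)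
    _ = _ := by ring

/-- The isometries `a`, `b` onto the two summands carry `T` and `S` to the corners of the
complementary projections `a a*` and `b b*`, which gives the upper bound. Compressing by `a*` or
`b*` recovers `T` or `S`, and (M2) gives the lower bound. -/
theorem hilbertNorm_blockDiag (hΦ : IsQStarNorm Φ) (hΨ : IsQNorm Ψ) {m n : ℕ}
    (T : Matrix (Fin m) (Fin m) H) (S : Matrix (Fin n) (Fin n) H) :
    hilbertNorm H Φ Ψ (m + n) (blockDiag T S) =
      max (hilbertNorm H Φ Ψ m T) (hilbertNorm H Φ Ψ n S) := by
  have hle := hΨ.le_of_isQStarNorm hΦ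
  have haa := conjTranspose_inlMatrix_mul_self m n
  have hbb := conjTranspose_inrMatrix_mul_self m n
  have hab := conjTranspose_inlMatrix_mul_inrMatrix m n
  have hba := conjTranspose_inrMatrix_mul_inlMatrix m n
  have hsum := inlMatrix_mul_add_inrMatrix_mul m n
  have na := norm_inlMatrix_le m n
  have nb := norm_inrMatrix_le m n
  have hTS := blockDiag_eq T S
  generalize inlMatrix m n = a at *
  generalize inrMatrix m n = b at *
  refine le_antisymm ?_ (max_le ?_ ?_)
  · have hQ : 1 - a * a.conjTranspose = b * b.conjTranspose := by rw [← hsum, add_sub_cancel_left]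
    rw [hTS]
    refine (hilbertNorm_add_le_max hΦ hΨ (P := a * a.conjTranspose) ?_ ?_ ?_ ?_).trans
      (max_le_max (hilbertNorm_scalarSandwich_le_of_norm_le_one hΦ.1 hΨ.1 hle na T)
        (hilbertNorm_scalarSandwich_le_of_norm_le_one hΦ.1 hΨ.1 hle nb S))
    · simp
    · rw [Matrix.mul_assoc, ← Matrix.mul_assoc a.conjTranspose, haa, Matrix.one_mul]
    · rw [scalarSandwich_scalarSandwich, Matrix.mul_assoc, haa, Matrix.mul_one,
        ← Matrix.mul_assoc, haa, Matrix.one_mul]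
    · rw [hQ, scalarSandwich_scalarSandwich, Matrix.mul_assoc, hbb, Matrix.mul_one,
        ← Matrix.mul_assoc, hbb, Matrix.one_mul]
  · have h := hilbertNorm_scalarSandwich_le_of_norm_le_one (Φ := Φ) (Ψ := Ψ) hΦ.1 hΨ.1 hle
      (a := a.conjTranspose) (by rwa [Matrix.l2_opNorm_conjTranspose]) (blockDiag T S)
    rwa [Matrix.conjTranspose_conjTranspose, hTS, scalarSandwich_add,
      scalarSandwich_scalarSandwich, scalarSandwich_scalarSandwich, haa, hab,
      scalarSandwich_zero_left, scalarSandwich_one, add_zero, ← hTS] at h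
  · have h := hilbertNorm_scalarSandwich_le_of_norm_le_one (Φ := Φ) (Ψ := Ψ) hΦ.1 hΨ.1 hle
      (a := b.conjTranspose) (by rwa [Matrix.l2_opNorm_conjTranspose]) (blockDiag T S)
    rwa [Matrix.conjTranspose_conjTranspose, hTS, scalarSandwich_add,
      scalarSandwich_scalarSandwich, scalarSandwich_scalarSandwich, hbb, hba,
      scalarSandwich_zero_left, scalarSandwich_one, zero_add, ← hTS] at h

end Blocks

theorem mainTheorem4 {H : Type*} [NormedAddCommGroup H] [InnerProductSpace ℂ H]
    [CompleteSpace H] [TopologicalSpace.SeparableSpace H] (hH : ¬ FiniteDimensional ℂ H)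
    (Φ Ψ : (ℕ →₀ ℝ) → ℝ) (hΦ : IsQStarNorm Φ) (hΨ : IsQNorm Ψ) :
    (∀ a, Ψ a ≤ Φ a) ∧ IsOperatorSpace (hilbertNorm H Φ Ψ) := by
  have hle := hΨ.le_of_isQStarNorm hΦ
  exact ⟨hle,
    { nonneg := fun n T => hilbertNorm_nonneg T
      eq_zero := fun n T => hilbertNorm_eq_zero hΦ.1 hΨ.1 hle
      smul := fun n c T => hilbertNorm_smul hΦ.1 hΨ.1 hle c T
      add_le := fun n T S => hilbertNorm_add_le hΦ.1 hΨ.1 hle T S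
      norm_one := fun e => hilbertNorm_fin_one hΦ.1 hΨ.1 hle e
      M1 := fun m n T S => hilbertNorm_blockDiag hΦ hΨ T S
      M2 := fun m n a T b => hilbertNorm_scalarSandwich_le hΦ.1 hΨ.1 hle a T b }⟩
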